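/- Let $R>0$ be fixed. For integers $k,d\ge 1$ let $\mathcal G_{k,d}$ be the set of distributions $\Gamma=\sum_{j=1}^k w_j\delta_{\mu_j}$ on $\mathbb R^d$ with $\|\mu_j\|_2\le R$, $w_j\ge 0$ and $\sum_{j=1}^k w_j=1$, and for $\Gamma\in\mathcal G_{k,d}$ let $P_\Gamma=\Gamma*N(0,I_d)$ be the corresponding $k$-component Gaussian mixture. Let $H(P,Q)=\big(\int(\sqrt p-\sqrt q)^2\,d\mu\big)^{1/2}$ be the Hellinger distance, where $p,q$ are the densities of $P,Q$ with respect to a dominating measure $\mu$. Let $X_1,\dots,X_n$ ($n\ge1$) be i.i.d. observations from $P_\Gamma$. (i) For every $k\ge 1$ there are constants $c,C>0$, depending only on $k$ and $R$, such that for all $d,n\ge 1$ $$c\Big(\sqrt{\tfrac dn}\wedge 1\Big)\ \le\ \inf_{\hat P}\ \sup_{\Gamma\in\mathcal G_{k,d}}\mathbb E_\Gamma H(\hat P,P_\Gamma)\ \le\ C\Big(\sqrt{\tfrac dn}\wedge 1\Big),$$ where the infimum is over all estimators $\hat P=\hat P(X_1,\dots,X_n)$ with values in the probability distributions on $\mathbb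 R^d$. The same two bounds hold when the infimum is restricted to proper estimators, i.e. those of the form $\hat P=P_{\hat\Gamma}$ with $\hat\Gamma=\hat\Gamma(X_1,\dots,X_n)\in\mathcal G_{k,d}$. (ii) There is a constant $C>0$, depending only on $R$, such that for all $k,d,n\ge 1$ there is a proper estimator $P_{\hat\Gamma}$, $\hat\Gamma=\hat\Gamma(X_1,\dots,X_n)\in\mathcal G_{k,d}$, such that for every $\Gamma\in\mathcal G_{k,d}$ and every $0<\delta<\tfrac12$, with probability at least $1-\delta$, $$H(P_{\hat\Gamma},P_\Gamma)\ \le\ C\sqrt{\frac{k^4d+(2k)^{2k+2}}{n}\,\log\frac1\delta}.$$ -/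

import Mathlib

open MeasureTheory ProbabilityTheory
open scoped ENNReal

noncomputable section

namespace GaussianMixture

/-- The class of `k`-atomic mixing distributions `∑ j, w j • δ_{μ j}` on `ℝ^d` whose atoms lie in the
closed Euclidean ball of radius `R` around the origin. The atoms may coincide and the weights may
vanish. -/
def mixingClass (R : ℝ) (k d : ℕ) : Set (Measure (EuclideanSpace ℝ (Fin d))) :=
  {Γ | ∃ (w : Fin k → ℝ) (μ : Fin k → EuclideanSpace ℝ (Fin d)),
    (∀ j, ‖μ j‖ ≤ R) ∧ (∀ j, 0 ≤ w j) ∧ ∑ j, w j = 1 ∧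
    Γ = ∑ j, ENNReal.ofReal (w j) • Measure.dirac (μ j)}

/-- The Gaussian mixture `P_Γ = Γ * N(0, I_d)` with mixing distribution `Γ`. -/
def mixture {d : ℕ} (Γ : Measure (EuclideanSpace ℝ (Fin d))) :
    Measure (EuclideanSpace ℝ (Fin d)) :=
  Measure.conv Γ (stdGaussian (EuclideanSpace ℝ (Fin d)))

/-- The Hellinger distance `H(P, Q) = (∫ (√p - √q)² dμ)^{1/2}`, where `p` and `q` are the densities
of `P` and `Q` with respect to the dominating measure `μ = P + Q`. -/
def hellinger {Ω : Type*} [MeasurableSpace Ω] (P Q : Measure Ω) : ℝ :=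
  √(∫ x, (√((P.rnDeriv (P + Q) x).toReal) - √((Q.rnDeriv (P + Q) x).toReal)) ^ 2 ∂(P + Q))

/-- The law of an i.i.d. sample `X_1, …, X_n` from `P_Γ`. -/
def sampleLaw {d : ℕ} (n : ℕ) (Γ : Measure (EuclideanSpace ℝ (Fin d))) :
    Measure (Fin n → EuclideanSpace ℝ (Fin d)) :=
  Measure.pi fun _ => mixture Γ

/-- An estimate of the mixture from `n` observations: a measurable map from samples to probability
measures on `ℝ^d`, not required to be mixtures. -/
def IsEstimator {n d : ℕ}
    (Phat : (Fin n → EuclideanSpace ℝ (Fin d)) → Measure (EuclideanSpace ℝ (Fin d))) : Prop :=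
  Measurable Phat ∧ ∀ x, IsProbabilityMeasure (Phat x)

/-- An estimate of the mixing distribution: a measurable map from samples to the class of mixing
distributions. The associated proper density estimate is `x ↦ mixture (Γhat x)`. -/
def IsMixingEstimator (R : ℝ) (k : ℕ) {n d : ℕ}
    (Γhat : (Fin n → EuclideanSpace ℝ (Fin d)) → Measure (EuclideanSpace ℝ (Fin d))) : Prop :=
  Measurable Γhat ∧ ∀ x, Γhat x ∈ mixingClass R k d

/-- The Hellinger risk `E_Γ H(Phat, P_Γ)`. -/
def risk {n d : ℕ}
    (Phat : (Fin n → EuclideanSpace ℝ (Fin d)) → Measure (EuclideanSpace ℝ (Fin d)))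
    (Γ : Measure (EuclideanSpace ℝ (Fin d))) : ℝ≥0∞ :=
  ∫⁻ x, ENNReal.ofReal (hellinger (Phat x) (mixture Γ)) ∂(sampleLaw n Γ)

/-- The minimax Hellinger risk over all estimators. -/
def minimaxRisk (R : ℝ) (k d n : ℕ) : ℝ≥0∞ :=
  ⨅ (Phat : (Fin n → EuclideanSpace ℝ (Fin d)) → Measure (EuclideanSpace ℝ (Fin d)))
    (_ : IsEstimator Phat), ⨆ Γ ∈ mixingClass R k d, risk Phat Γ

/-- The minimax Hellinger risk over proper estimators. -/
def properMinimaxRisk (R : ℝ) (k d n : ℕ) : ℝ≥0∞ :=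
  ⨅ (Γhat : (Fin n → EuclideanSpace ℝ (Fin d)) → Measure (EuclideanSpace ℝ (Fin d)))
    (_ : IsMixingEstimator R k Γhat),
    ⨆ Γ ∈ mixingClass R k d, risk (fun x => mixture (Γhat x)) Γ

end GaussianMixture

end

/-!
Upper bounds. Relative to `N(0, I)`, the squared `L²` distance of two mixtures is the squared norm
of the difference of the mixing measures for the kernel `exp ⟪x, y⟫ = ∑ ⟪x, y⟫ ^ l / l!`, that is,
a weighted sum of the squared norms of the moment tensors of this difference. The difference has at
most `2 * k` atoms, so its moments of order less than `2 * k` control all others, with constants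
that do not depend on the dimension. A mixture at a bounded distance is thus encoded by a frame of
`2 * k` vectors for the span of the atoms, and by at most `(2 * k) ^ (2 * k)` moments along the
frame; this bounds the local packing numbers. Exponential tilts of the mixing measure compare the
`χ²`-divergence with the `L²` distance. Maximum likelihood over a maximal packing then attains the
rate, since the square root of a likelihood ratio has an expectation that is exponentially small in
`n` times the squared Hellinger distance.

Lower bound. Assouad's lemma applies to the Gaussian measures centred at the vertices of a cube of
side length of order `√(1 / n)`, or of order `√(1 / d)` if `n < d`. The distance of two of the
centres is bounded by the Hellinger distance of the Gaussian measures, by testing against a sine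
wave; so any estimator can be rounded to a vertex.
-/

noncomputable section

namespace GaussianMixture

open scoped RealInnerProductSpace

/-- A signed measure `∑ i, weight i • δ_{atom i}`. The presentation by weights and atoms is part of
the data: atoms may coincide and weights may vanish. -/
structure AtomicMeasure (ι E : Type*) where
  /-- The mass placed on the `i`-th atom. -/
  weight : ι → ℝ
  /-- The position of the `i`-th atom. -/
  atom : ι → E

section ParsevalFrame

variable {ι κ E : Type*} [Fintype κ] [NormedAddCommGroup E] [InnerProductSpace ℝ E]

/-- The vectors `v` act as an orthonormal basis for the vectors `x`. Unlike an orthonormal basis of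
their span, such a family may be indexed like `x` itself, by padding with zero vectors. -/
structure IsParsevalFrame (v : κ → E) (x : ι → E) : Prop where
  bessel : ∀ u, ∑ b, ⟪v b, u⟫ ^ 2 ≤ ‖u‖ ^ 2
  sum_inner_smul : ∀ i, ∑ b, ⟪v b, x i⟫ • v b = x i

theorem exists_isParsevalFrame (x : κ → E) : ∃ v : κ → E, IsParsevalFrame v x := by
  classical
  let S := Submodule.span ℝ (Set.range x)
  have : FiniteDimensional ℝ S := FiniteDimensional.span_of_finite ℝ (Set.finite_range x)
  let e := stdOrthonormalBasis ℝ S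
  obtain ⟨f⟩ : Nonempty (Fin (Module.finrank ℝ S) ↪ κ) :=
    Function.Embedding.nonempty_of_card_le ((Fintype.card_fin _).trans_le (finrank_range_le_card x))
  let v : κ → E := Function.extend f (fun a => (e a : E)) 0
  have v_f (a) : v (f a) = e a := f.injective.extend_apply _ _ _
  have v_off (b) (hb : b ∉ Set.range f) : v b = 0 := Function.extend_apply' _ _ _ hb
  have ortho : Orthonormal ℝ fun a => (e a : E) :=
    e.orthonormal.comp_linearIsometry S.subtypeₗᵢ
  refine ⟨v, fun u => ?_, fun i => ?_⟩
  · rw [← Fintype.sum_of_injective f f.injective (fun a => ⟪(e a : E), u⟫ ^ 2) _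
      (fun b hb => by simp [v_off b hb]) fun a => by rw [v_f]]
    simpa [sq_abs] using ortho.sum_inner_products_le u (s := Finset.univ)
  · rw [← Fintype.sum_of_injective f f.injective (fun a => ⟪(e a : E), x i⟫ • (e a : E)) _
      (fun b hb => by simp [v_off b hb]) fun a => by rw [v_f]]
    simpa using congrArg Subtype.val
      (e.sum_repr' ⟨x i, Submodule.subset_span (Set.mem_range_self i)⟩)

namespace IsParsevalFrame

variable {v : κ → E} {x : ι → E}

theorem norm_le_one (hv : IsParsevalFrame v x) (b : κ) : ‖v b‖ ≤ 1 := by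
  have h : (‖v b‖ ^ 2) ^ 2 ≤ ‖v b‖ ^ 2 := by
    rw [← real_inner_self_eq_norm_sq]
    exact (Finset.single_le_sum (f := fun b' => ⟪v b', v b⟫ ^ 2) (fun _ _ => sq_nonneg _)
      (Finset.mem_univ b)).trans ((hv.bessel _).trans_eq (real_inner_self_eq_norm_sq _).symm)
  by_contra! hlt
  nlinarith [one_lt_pow₀ hlt two_ne_zero]

theorem norm_le (hv : IsParsevalFrame v x) : ‖v‖ ≤ 1 :=
  (pi_norm_le_iff_of_nonneg zero_le_one).2 hv.norm_le_one

theorem inner_eq_sum (hv : IsParsevalFrame v x) (u : E) (i : ι) :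
    ⟪u, x i⟫ = ∑ b, ⟪u, v b⟫ * ⟪v b, x i⟫ := by
  conv_lhs => rw [← hv.sum_inner_smul i]
  simp only [inner_sum, inner_smul_right, mul_comm]

end IsParsevalFrame

end ParsevalFrame

namespace AtomicMeasure

variable {ι κ E : Type*}

/-- The measure with density `f` with respect to an atomic measure. -/
def reweight (γ : AtomicMeasure ι E) (f : E → ℝ) : AtomicMeasure ι E where
  weight i := γ.weight i * f (γ.atom i)
  atom := γ.atom

/-- The difference of two atomic measures, presented on the disjoint union of their atoms. -/
def diff (γ : AtomicMeasure ι E) (γ' : AtomicMeasure κ E) : AtomicMeasure (ι ⊕ κ) E where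
  weight := Sum.elim γ.weight (-γ'.weight)
  atom := Sum.elim γ.atom γ'.atom

theorem norm_atom_diff_le {E : Type*} [Norm E] {γ : AtomicMeasure ι E} {γ' : AtomicMeasure κ E}
    {R : ℝ} (h : ∀ i, ‖γ.atom i‖ ≤ R) (h' : ∀ i, ‖γ'.atom i‖ ≤ R) (i : ι ⊕ κ) :
    ‖(γ.diff γ').atom i‖ ≤ R :=
  Sum.rec h h' i

variable [Fintype ι] [Fintype κ]

/-- The integral of `f` with respect to an atomic measure. -/
def integral (γ : AtomicMeasure ι E) (f : E → ℝ) : ℝ := ∑ i, γ.weight i * f (γ.atom i)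

theorem integral_reweight (γ : AtomicMeasure ι E) (f g : E → ℝ) :
    (γ.reweight f).integral g = γ.integral fun x => f x * g x := by
  simp only [integral, reweight, mul_assoc]

theorem integral_diff (γ : AtomicMeasure ι E) (γ' : AtomicMeasure κ E) (f : E → ℝ) :
    (γ.diff γ').integral f = γ.integral f - γ'.integral f := by
  simp [integral, diff, sub_eq_add_neg]

theorem integral_sub (γ : AtomicMeasure ι E) (f g : E → ℝ) :
    (γ.integral fun x => f x - g x) = γ.integral f - γ.integral g := by
  simp only [integral, mul_sub, Finset.sum_sub_distrib]

theorem integral_const_mul (γ : AtomicMeasure ι E) (a : ℝ) (f : E → ℝ) :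
    (γ.integral fun x => a * f x) = a * γ.integral f := by
  simp only [integral, Finset.mul_sum, mul_left_comm]

theorem integral_finsetSum {α : Type*} (γ : AtomicMeasure ι E) (s : Finset α) (f : α → E → ℝ) :
    (γ.integral fun x => ∑ a ∈ s, f a x) = ∑ a ∈ s, γ.integral (f a) := by
  simp only [integral, Finset.mul_sum]
  exact Finset.sum_comm

theorem hasSum_integral (γ : AtomicMeasure ι E) {f : ℕ → E → ℝ} {g : E → ℝ}
    (h : ∀ i, HasSum (fun l => f l (γ.atom i)) (g (γ.atom i))) :
    HasSum (fun l => γ.integral (f l)) (γ.integral g) :=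
  hasSum_sum fun i _ => (h i).mul_left _

variable [NormedAddCommGroup E] [InnerProductSpace ℝ E] {γ : AtomicMeasure ι E} {R A B Q : ℝ}

/-- The moment tensor `∑ i, weight i • (atom i)^{⊗ l}`, evaluated at `l` test vectors. -/
def moment (γ : AtomicMeasure ι E) {l : ℕ} (u : Fin l → E) : ℝ := γ.integral fun x => ∏ p, ⟪u p, x⟫

/-- The squared Hilbert–Schmidt norm of the `l`-th moment tensor. -/
def momentNormSq (γ : AtomicMeasure ι E) (l : ℕ) : ℝ :=
  γ.integral fun x => γ.integral fun y => ⟪x, y⟫ ^ l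

/-- The squared norm of an atomic measure in the reproducing kernel Hilbert space of the kernel
`exp ⟪x, y⟫`. It generates all the moment norms at once, and it is also the squared `L²` norm of the
density of the associated Gaussian mixture with respect to the standard Gaussian measure. -/
def energy (γ : AtomicMeasure ι E) : ℝ := γ.integral fun x => γ.integral fun y => Real.exp ⟪x, y⟫

/-- The exponential tilt of an atomic measure in the direction `z`. -/
def tilt (γ : AtomicMeasure ι E) (z : E) : AtomicMeasure ι E := γ.reweight fun x => Real.exp ⟪z, x⟫

theorem moment_reweight_inner_sub {l : ℕ} (w y : E) (u : Fin l → E) :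
    (γ.reweight fun x => ⟪w, x - y⟫).moment u
      = γ.moment (Fin.cons w u : Fin (l + 1) → E) - ⟪w, y⟫ * γ.moment u := by
  simp only [moment, integral_reweight, Fin.prod_univ_succ, Fin.cons_zero, Fin.cons_succ,
    inner_sub_right, sub_mul, integral_sub, integral_const_mul]

theorem abs_moment_reweight_inner_sub_le {l : ℕ} {w y : E} {u : Fin l → E}
    {b : ℝ} (hy : |⟪w, y⟫| ≤ b) (hu : |γ.moment u| ≤ B) :
    |(γ.reweight fun x => ⟪w, x - y⟫).moment u|
      ≤ |γ.moment (Fin.cons w u : Fin (l + 1) → E)| + b * B := by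
  rw [moment_reweight_inner_sub]
  refine (abs_sub _ _).trans ?_
  rw [abs_mul]
  gcongr
  exact (abs_nonneg _).trans hy

/- Multiplying by `⟪w, x - a⟫` kills the atom `a` and turns moments into differences of moments, so
the first `card` moments of a measure determine all of them, by induction on the support. -/
theorem abs_moment_le_of_support (hR : 0 ≤ R) (hA : 0 ≤ A) (s : Finset ι)
    (hγ : ∀ i, ‖γ.atom i‖ ≤ R) (hs : ∀ i ∉ s, γ.weight i = 0)
    (h : ∀ l < s.card, ∀ u : Fin l → E, |γ.moment u| ≤ A * ∏ p, ‖u p‖)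
    {l : ℕ} (u : Fin l → E) : |γ.moment u| ≤ (1 + 2 * R) ^ l * A * ∏ p, ‖u p‖ := by
  classical
  induction s using Finset.induction_on generalizing γ A l with
  | empty =>
    have : γ.moment u = 0 := by simp [moment, integral, hs]
    rw [this, abs_zero]
    positivity
  | insert a s ha ih =>
    rw [Finset.card_insert_of_notMem ha] at h
    induction l with
    | zero => simpa using h 0 (by lia) u
    | succ l ihl =>
      obtain ⟨w, u, rfl⟩ : ∃ w u', u = Fin.cons w u' :=
        ⟨u 0, Fin.tail u, (Fin.cons_self_tail u).symm⟩
      have inner_le : |⟪w, γ.atom a⟫| ≤ R * ‖w‖ :=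
        (abs_real_inner_le_norm _ _).trans
          ((mul_comm _ _).trans_le (mul_le_mul_of_nonneg_right (hγ a) (norm_nonneg w)))
      have reweighted : |(γ.reweight fun x => ⟪w, x - γ.atom a⟫).moment u|
          ≤ (1 + 2 * R) ^ l * ((1 + R) * ‖w‖ * A) * ∏ p, ‖u p‖ := by
        refine ih (γ := γ.reweight fun x => ⟪w, x - γ.atom a⟫) (by positivity) hγ ?_ ?_ u
        · intro i hi
          by_cases hia : i = a
          · simp [reweight, hia]
          · simp [reweight, hs i (by simp [hi, hia])]
        · intro m hm t
          have long := h (m + 1) (by lia) (Fin.cons w t)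
          simp only [Fin.prod_univ_succ, Fin.cons_zero, Fin.cons_succ] at long
          linarith [abs_moment_reweight_inner_sub_le inner_le (h m (by lia) t)]
      rw [← sub_add_cancel (γ.moment _) (⟪w, γ.atom a⟫ * γ.moment u), ← moment_reweight_inner_sub]
      simp only [Fin.prod_univ_succ, Fin.cons_zero, Fin.cons_succ]
      calc _ ≤ (1 + 2 * R) ^ l * ((1 + R) * ‖w‖ * A) * ∏ p, ‖u p‖
              + R * ‖w‖ * ((1 + 2 * R) ^ l * A * ∏ p, ‖u p‖) := by
            refine (abs_add_le _ _).trans ?_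
            rw [abs_mul]
            gcongr
            exact ihl u
        _ = _ := by ring

theorem abs_moment_le (hR : 0 ≤ R) (hA : 0 ≤ A) (hγ : ∀ i, ‖γ.atom i‖ ≤ R)
    (h : ∀ l < Fintype.card ι, ∀ u : Fin l → E, |γ.moment u| ≤ A * ∏ p, ‖u p‖)
    {l : ℕ} (u : Fin l → E) : |γ.moment u| ≤ (1 + 2 * R) ^ l * A * ∏ p, ‖u p‖ :=
  abs_moment_le_of_support hR hA Finset.univ hγ (fun i hi => absurd (Finset.mem_univ i) hi) h u

theorem moment_eq_sum_of_isParsevalFrame {v : κ → E} (hv : IsParsevalFrame v γ.atom) {l : ℕ}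
    (u : Fin l → E) :
    γ.moment u = ∑ α : Fin l → κ, (∏ p, ⟪u p, v (α p)⟫) * γ.moment (v ∘ α) := by
  classical
  simp_rw [moment, ← integral_const_mul, ← integral_finsetSum]
  refine Finset.sum_congr rfl fun i _ => ?_
  have expand (p) := hv.inner_eq_sum (u p) i
  simp_rw [expand, Fintype.prod_sum, Finset.prod_mul_distrib, Function.comp_apply]

theorem sum_sq_moment_of_isParsevalFrame {v : κ → E} (hv : IsParsevalFrame v γ.atom) (l : ℕ) :
    ∑ α : Fin l → κ, γ.moment (v ∘ α) ^ 2 = γ.momentNormSq l := by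
  have inner (i) : (γ.integral fun y => ⟪γ.atom i, y⟫ ^ l)
      = ∑ α : Fin l → κ, γ.moment (v ∘ α) * ∏ p, ⟪v (α p), γ.atom i⟫ := by
    calc _ = γ.moment fun _ : Fin l => γ.atom i := by simp [moment]
      _ = _ := moment_eq_sum_of_isParsevalFrame hv _
      _ = _ := Finset.sum_congr rfl fun α _ => by
        rw [mul_comm]
        exact congrArg _ (Finset.prod_congr rfl fun p _ => real_inner_comm _ _)
  calc _ = γ.integral fun x => ∑ α : Fin l → κ, γ.moment (v ∘ α) * ∏ p, ⟪v (α p), x⟫ := by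
        simp_rw [integral_finsetSum, integral_const_mul, sq]
        rfl
    _ = _ := Finset.sum_congr rfl fun i _ => congrArg (γ.weight i * ·) (inner i).symm

theorem momentNormSq_nonneg (γ : AtomicMeasure ι E) (l : ℕ) : 0 ≤ γ.momentNormSq l := by
  obtain ⟨v, hv⟩ := exists_isParsevalFrame γ.atom
  rw [← sum_sq_moment_of_isParsevalFrame hv]
  positivity

theorem sq_moment_le_momentNormSq_mul (γ : AtomicMeasure ι E) {l : ℕ} (u : Fin l → E) :
    γ.moment u ^ 2 ≤ γ.momentNormSq l * (∏ p, ‖u p‖) ^ 2 := by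
  classical
  obtain ⟨v, hv⟩ := exists_isParsevalFrame γ.atom
  have bessel : ∑ α : Fin l → ι, (∏ p, ⟪u p, v (α p)⟫) ^ 2 ≤ (∏ p, ‖u p‖) ^ 2 := by
    simp_rw [← Finset.prod_pow, ← Fintype.prod_sum fun p b => ⟪u p, v b⟫ ^ 2]
    refine Finset.prod_le_prod (fun _ _ => by positivity) fun p _ => ?_
    simpa only [real_inner_comm] using hv.bessel (u p)
  rw [moment_eq_sum_of_isParsevalFrame hv, ← sum_sq_moment_of_isParsevalFrame hv, mul_comm]
  exact (Finset.sum_mul_sq_le_sq_mul_sq _ _ _).trans (by gcongr)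

theorem momentNormSq_le {l : ℕ} (h : ∀ u : Fin l → E, |γ.moment u| ≤ B * ∏ p, ‖u p‖) (hB : 0 ≤ B) :
    γ.momentNormSq l ≤ Fintype.card ι ^ l * B ^ 2 := by
  obtain ⟨v, hv⟩ := exists_isParsevalFrame γ.atom
  rw [← sum_sq_moment_of_isParsevalFrame hv]
  have term (α : Fin l → ι) : γ.moment (v ∘ α) ^ 2 ≤ B ^ 2 := by
    refine sq_le_sq.2 ((h _).trans ((mul_le_of_le_one_right hB ?_).trans (le_abs_self B)))
    exact Finset.prod_le_one (fun _ _ => norm_nonneg _) fun p _ => hv.norm_le_one _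
  exact (Finset.sum_le_card_nsmul _ _ _ fun α _ => term α).trans_eq (by simp)

theorem hasSum_exp_real (x : ℝ) :
    HasSum (fun l : ℕ => x ^ l / l.factorial) (Real.exp x) := by
  rw [Real.exp_eq_exp_ℝ]
  exact NormedSpace.expSeries_div_hasSum_exp x

theorem hasSum_momentNormSq (γ : AtomicMeasure ι E) :
    HasSum (fun l : ℕ => γ.momentNormSq l / l.factorial) γ.energy := by
  simp_rw [div_eq_inv_mul, momentNormSq, ← integral_const_mul]
  refine γ.hasSum_integral fun i => γ.hasSum_integral fun j => ?_
  simpa only [div_eq_inv_mul] using hasSum_exp_real ⟪γ.atom i, γ.atom j⟫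

theorem energy_nonneg (γ : AtomicMeasure ι E) : 0 ≤ γ.energy :=
  γ.hasSum_momentNormSq.nonneg fun l => div_nonneg (γ.momentNormSq_nonneg l) (by positivity)

theorem momentNormSq_le_factorial_mul_energy (γ : AtomicMeasure ι E) (l : ℕ) :
    γ.momentNormSq l ≤ l.factorial * γ.energy := by
  rw [← div_le_iff₀' (by positivity)]
  exact le_hasSum γ.hasSum_momentNormSq l fun j _ =>
    div_nonneg (γ.momentNormSq_nonneg j) (by positivity)

theorem abs_moment_le_sqrt_energy (γ : AtomicMeasure ι E) {l N : ℕ} (hl : l ≤ N) (u : Fin l → E) :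
    |γ.moment u| ≤ √(N.factorial * γ.energy) * ∏ p, ‖u p‖ := by
  have norm_le : γ.momentNormSq l ≤ N.factorial * γ.energy :=
    (γ.momentNormSq_le_factorial_mul_energy l).trans
      (mul_le_mul_of_nonneg_right (by gcongr) γ.energy_nonneg)
  rw [← Real.sqrt_sq (Finset.prod_nonneg fun p _ => norm_nonneg (u p)),
    ← Real.sqrt_mul' _ (by positivity)]
  exact Real.abs_le_sqrt ((γ.sq_moment_le_momentNormSq_mul u).trans (by gcongr))

theorem energy_le (hQ : 0 ≤ Q) (hB : 0 ≤ B)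
    (h : ∀ (l : ℕ) (u : Fin l → E), |γ.moment u| ≤ Q ^ l * B * ∏ p, ‖u p‖) :
    γ.energy ≤ Real.exp (Fintype.card ι * Q ^ 2) * B ^ 2 := by
  refine hasSum_le (fun l => ?_) γ.hasSum_momentNormSq
    ((hasSum_exp_real (Fintype.card ι * Q ^ 2)).mul_right (B ^ 2))
  rw [div_mul_eq_mul_div]
  gcongr
  exact (momentNormSq_le (h l) (by positivity)).trans_eq (by ring)

theorem hasSum_moment_tilt (γ : AtomicMeasure ι E) (z : E) {l : ℕ} (u : Fin l → E) :
    HasSum (fun r : ℕ => γ.moment (Fin.append u fun _ : Fin r => z) / r.factorial)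
      ((γ.tilt z).moment u) := by
  simp_rw [div_eq_inv_mul, moment, tilt, integral_reweight, ← integral_const_mul]
  refine γ.hasSum_integral fun i => ?_
  simpa [Fin.prod_univ_add, div_eq_inv_mul, mul_assoc, mul_left_comm, mul_comm] using
    (hasSum_exp_real ⟪z, γ.atom i⟫).mul_right (∏ p, ⟪u p, γ.atom i⟫)

theorem abs_moment_tilt_le (hQ : 0 ≤ Q) (hB : 0 ≤ B)
    (h : ∀ (l : ℕ) (u : Fin l → E), |γ.moment u| ≤ Q ^ l * B * ∏ p, ‖u p‖) {z : E} (hz : ‖z‖ ≤ R)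
    {l : ℕ} (u : Fin l → E) :
    |(γ.tilt z).moment u| ≤ Q ^ l * (Real.exp (R * Q) * B) * ∏ p, ‖u p‖ := by
  have bound := (hasSum_exp_real (R * Q)).mul_right (Q ^ l * B * ∏ p, ‖u p‖)
  rw [← (γ.hasSum_moment_tilt z u).tsum_eq, ← Real.norm_eq_abs]
  refine (tsum_of_norm_bounded bound fun r => ?_).trans_eq (by ring)
  rw [Real.norm_eq_abs, abs_div, Nat.abs_cast, div_mul_eq_mul_div]
  gcongr
  calc _ ≤ Q ^ (l + r) * B * ((∏ p, ‖u p‖) * ‖z‖ ^ r) :=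
        (h _ _).trans_eq (by simp [Fin.prod_univ_add])
    _ ≤ Q ^ (l + r) * B * ((∏ p, ‖u p‖) * R ^ r) := by gcongr
    _ = _ := by ring

/-- A bound for the operator norm of the tilts of size at most `R` on the measures with `N` atoms in
the ball of radius `R`, with respect to `energy`. -/
def tiltConst (R : ℝ) (N : ℕ) : ℝ :=
  Real.exp (N * (1 + 2 * R) ^ 2 + 2 * (R * (1 + 2 * R))) * N.factorial

theorem tiltConst_pos (R : ℝ) (N : ℕ) : 0 < tiltConst R N := by
  unfold tiltConst
  positivity

theorem energy_tilt_le (hR : 0 ≤ R) (hγ : ∀ i, ‖γ.atom i‖ ≤ R) {z : E} (hz : ‖z‖ ≤ R) :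
    (γ.tilt z).energy ≤ tiltConst R (Fintype.card ι) * γ.energy := by
  set N := Fintype.card ι with hN
  have hQ : 0 ≤ 1 + 2 * R := by positivity
  have moment_le {l : ℕ} (u : Fin l → E) :=
    abs_moment_le hR (Real.sqrt_nonneg _) hγ
      (fun l hl u => γ.abs_moment_le_sqrt_energy (N := N) hl.le u) u
  have := γ.energy_nonneg
  refine (energy_le hQ (by positivity) fun l =>
    abs_moment_tilt_le hQ (Real.sqrt_nonneg _) (fun l => moment_le) hz).trans_eq ?_
  rw [← hN, tiltConst, mul_pow, Real.sq_sqrt (by positivity), Real.exp_add, ← Real.exp_nat_mul,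
    Nat.cast_ofNat]
  ring

end AtomicMeasure

theorem card_le_of_separated {α F : Type*} [NormedAddCommGroup F] [NormedSpace ℝ F]
    [FiniteDimensional ℝ F] {η : ℝ} (hη : 0 < η) (s : Finset α) (f : α → F)
    (hf : ∀ a ∈ s, ‖f a‖ ≤ 1) (hs : (s : Set α).Pairwise fun a b => η ≤ dist (f a) (f b)) :
    (s.card : ℝ) ≤ (1 + 2 / η) ^ Module.finrank ℝ F := by
  borelize F
  let μ : Measure F := Measure.addHaar
  let A := ⋃ a ∈ s, Metric.ball (f a) (η / 2)
  have disjoint : (s : Set α).Pairwise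
      (Function.onFun Disjoint fun a => Metric.ball (f a) (η / 2)) :=
    fun a ha b hb hab => Metric.ball_disjoint_ball ((add_halves η).trans_le (hs ha hb hab))
  have A_subset : A ⊆ Metric.ball (0 : F) (1 + η / 2) := by
    refine Set.iUnion₂_subset fun a ha => Metric.ball_subset_ball' ?_
    rw [dist_zero_right]
    linarith [hf a ha]
  have volume_le : s.card * ENNReal.ofReal ((η / 2) ^ Module.finrank ℝ F) * μ (Metric.ball 0 1)
      ≤ ENNReal.ofReal ((1 + η / 2) ^ Module.finrank ℝ F) * μ (Metric.ball 0 1) :=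
    calc _ = μ A := by
          rw [measure_biUnion_finset disjoint fun _ _ => measurableSet_ball]
          simp only [μ.addHaar_ball_of_pos _ (half_pos hη), Finset.sum_const, nsmul_eq_mul,
            mul_assoc]
      _ ≤ μ (Metric.ball (0 : F) (1 + η / 2)) := measure_mono A_subset
      _ = _ := μ.addHaar_ball_of_pos _ (by positivity)
  have card_le := ENNReal.toReal_le_of_le_ofReal (by positivity) ((ENNReal.mul_le_mul_iff_left
    (Metric.measure_ball_pos _ _ zero_lt_one).ne' measure_ball_lt_top.ne).1 volume_le)
  rw [ENNReal.toReal_mul, ENNReal.toReal_natCast, ENNReal.toReal_ofReal (by positivity),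
    ← le_div_iff₀ (by positivity), ← div_pow] at card_le
  refine card_le.trans_eq (congrArg (· ^ _) ?_)
  field_simp
  ring

theorem sum_pow_le_pow_self (N : ℕ) : ∑ l : Fin N, N ^ (l : ℕ) ≤ N ^ N := by
  obtain _ | N := N
  · simp
  · calc _ ≤ ∑ _l : Fin (N + 1), (N + 1) ^ N :=
          Finset.sum_le_sum fun l _ => Nat.pow_le_pow_right N.succ_pos (Nat.le_of_lt_succ l.2)
      _ = _ := by simp [pow_succ']

section

variable {ι κ E : Type*} [NormedAddCommGroup E] [InnerProductSpace ℝ E]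

theorem abs_prod_inner_sub_prod_inner_le {l : ℕ} (u : Fin l → E) {v w : Fin l → E}
    (hv : ‖v‖ ≤ 1) (hw : ‖w‖ ≤ 1) :
    |∏ p, ⟪u p, v p⟫ - ∏ p, ⟪u p, w p⟫| ≤ l * ‖v - w‖ * ∏ p, ‖u p‖ := by
  let f := (ContinuousMultilinearMap.mkPiAlgebra ℝ (Fin l) ℝ).compContinuousLinearMap
    fun p => innerSL ℝ (u p)
  have norm_f : ‖f‖ ≤ ∏ p, ‖u p‖ := by
    refine (ContinuousMultilinearMap.norm_compContinuousLinearMap_le _ _).trans_eq ?_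
    simp only [ContinuousMultilinearMap.norm_mkPiAlgebra, innerSL_apply_norm, one_mul]
  calc _ = ‖f v - f w‖ := by simp [f]
    _ ≤ ‖f‖ * l * max ‖v‖ ‖w‖ ^ (l - 1) * ‖v - w‖ := by simpa using f.norm_image_sub_le v w
    _ ≤ (∏ p, ‖u p‖) * l * 1 * ‖v - w‖ := by
      gcongr
      exact pow_le_one₀ (by positivity) (max_le hv hw)
    _ = _ := by ring

namespace AtomicMeasure

variable {ι' : Type*} [Fintype ι'] [Fintype ι]

/-- The moments of order less than `N` of an atomic measure along the vectors `v`. -/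
def shortMoments (γ : AtomicMeasure ι E) (v : κ → E) (N : ℕ) :
    (Σ l : Fin N, Fin l → κ) → ℝ :=
  fun α => γ.moment (v ∘ α.2)

theorem moment_diff {γ : AtomicMeasure ι E} {γ' : AtomicMeasure ι' E} {l : ℕ} (u : Fin l → E) :
    (γ.diff γ').moment u = γ.moment u - γ'.moment u :=
  integral_diff _ _ _

variable [Fintype κ] {γ : AtomicMeasure ι E} {γ' : AtomicMeasure ι' E} {v v' : κ → E}
  {M R η : ℝ} {N : ℕ}

theorem norm_shortMoments_le (hv : ‖v‖ ≤ 1) :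
    ‖γ.shortMoments v N‖ ≤ √(N.factorial * γ.energy) := by
  refine (pi_norm_le_iff_of_nonneg (Real.sqrt_nonneg _)).2 fun α => ?_
  refine (γ.abs_moment_le_sqrt_energy α.1.2.le _).trans
    (mul_le_of_le_one_right (Real.sqrt_nonneg _) ?_)
  exact Finset.prod_le_one (fun _ _ => norm_nonneg _) fun p _ => (norm_le_pi_norm v _).trans hv

theorem abs_moment_sub_moment_le (hv : IsParsevalFrame v γ.atom)
    (hv' : IsParsevalFrame v' γ'.atom) (hM : ‖γ.shortMoments v N‖ ≤ M) (hη : ‖v - v'‖ ≤ η)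
    (hMη : ‖γ.shortMoments v N - γ'.shortMoments v' N‖ ≤ η * M) {l : ℕ} (hl : l < N)
    (u : Fin l → E) :
    |γ.moment u - γ'.moment u| ≤ Fintype.card κ ^ l * ((l + 1) * η * M) * ∏ p, ‖u p‖ := by
  have comp_le (w : κ → E) (α : Fin l → κ) : ‖w ∘ α‖ ≤ ‖w‖ :=
    (pi_norm_le_iff_of_nonneg (norm_nonneg _)).2 fun p => norm_le_pi_norm w (α p)
  have η_nonneg := (norm_nonneg _).trans hη
  have term (α : Fin l → κ) : |(∏ p, ⟪u p, v (α p)⟫) * γ.moment (v ∘ α)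
      - (∏ p, ⟪u p, v' (α p)⟫) * γ'.moment (v' ∘ α)| ≤ (l + 1) * η * M * ∏ p, ‖u p‖ := by
    have prod_sub := abs_prod_inner_sub_prod_inner_le u ((comp_le v α).trans hv.norm_le)
      ((comp_le v' α).trans hv'.norm_le)
    have prod_le : |∏ p, ⟪u p, v' (α p)⟫| ≤ ∏ p, ‖u p‖ := by
      rw [Finset.abs_prod]
      refine Finset.prod_le_prod (fun _ _ => abs_nonneg _) fun p _ => ?_
      exact (abs_real_inner_le_norm _ _).trans
        (mul_le_of_le_one_right (norm_nonneg _) ((norm_le_pi_norm v' _).trans hv'.norm_le))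
    have moment_le : |γ.moment (v ∘ α)| ≤ M := (norm_le_pi_norm (γ.shortMoments v N)
      ⟨⟨l, hl⟩, α⟩).trans hM
    have moment_sub : |γ.moment (v ∘ α) - γ'.moment (v' ∘ α)| ≤ η * M :=
      (norm_le_pi_norm (γ.shortMoments v N - γ'.shortMoments v' N) ⟨⟨l, hl⟩, α⟩).trans hMη
    calc _ = |(∏ p, ⟪u p, v (α p)⟫ - ∏ p, ⟪u p, v' (α p)⟫) * γ.moment (v ∘ α)
            + (∏ p, ⟪u p, v' (α p)⟫) * (γ.moment (v ∘ α) - γ'.moment (v' ∘ α))| := by ring_nf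
      _ ≤ (l * η * ∏ p, ‖u p‖) * M + (∏ p, ‖u p‖) * (η * M) := by
          refine (abs_add_le _ _).trans ?_
          rw [abs_mul, abs_mul]
          gcongr
          exact prod_sub.trans (by gcongr; exact (comp_le (v - v') α).trans hη)
      _ = _ := by ring
  rw [moment_eq_sum_of_isParsevalFrame hv, moment_eq_sum_of_isParsevalFrame hv',
    ← Finset.sum_sub_distrib]
  calc _ ≤ ∑ _α : Fin l → κ, (l + 1) * η * M * ∏ p, ‖u p‖ :=
        (Finset.abs_sum_le_sum_abs _ _).trans (Finset.sum_le_sum fun α _ => term α)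
    _ = _ := by simp [mul_assoc]

/-- The squared distance of two atomic measures with respect to `energy`. -/
def sqDist (γ : AtomicMeasure ι E) (γ' : AtomicMeasure ι' E) : ℝ := (γ.diff γ').energy

theorem sqDist_nonneg (γ : AtomicMeasure ι E) (γ' : AtomicMeasure ι' E) : 0 ≤ γ.sqDist γ' :=
  energy_nonneg _

/-- A Lipschitz constant of the decoder that recovers, up to `sqDist`, a measure with `N / 2` atoms
in the ball of radius `R` from its frame and its moments along this frame. -/
def decodingConst (R : ℝ) (N : ℕ) : ℝ :=
  N ^ N * √N.factorial * Real.exp (N * (1 + 2 * R) ^ 2 / 2)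

theorem one_le_decodingConst (R : ℝ) (N : ℕ) : 1 ≤ decodingConst R N := by
  have pow_self : (1 : ℝ) ≤ N ^ N := by exact_mod_cast Nat.pow_self_pos
  have sqrt_factorial : 1 ≤ √(N.factorial : ℝ) :=
    Real.one_le_sqrt.2 (by exact_mod_cast N.factorial_pos)
  exact one_le_mul_of_one_le_of_one_le
    (one_le_mul_of_one_le_of_one_le pow_self sqrt_factorial) (Real.one_le_exp (by positivity))

theorem sqDist_le_of_shortMoments_close {γ γ' γ₀ : AtomicMeasure ι E} {v v' : ι ⊕ ι → E} {r : ℝ}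
    (hR : 0 ≤ R) (hγ : ∀ i, ‖γ.atom i‖ ≤ R) (hγ' : ∀ i, ‖γ'.atom i‖ ≤ R)
    (hN : N = Fintype.card (ι ⊕ ι)) (hr : 0 ≤ r) (hγr : γ.sqDist γ₀ ≤ r ^ 2)
    (hv : IsParsevalFrame v (γ.diff γ₀).atom) (hv' : IsParsevalFrame v' (γ'.diff γ₀).atom)
    (hη : ‖v - v'‖ ≤ η)
    (hMη : ‖(γ.diff γ₀).shortMoments v N - (γ'.diff γ₀).shortMoments v' N‖
      ≤ η * (√N.factorial * r)) :
    γ.sqDist γ' ≤ (decodingConst R N * (η * r)) ^ 2 := by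
  have η_nonneg := (norm_nonneg _).trans hη
  have moment_bound : ‖(γ.diff γ₀).shortMoments v N‖ ≤ √N.factorial * r := by
    refine (norm_shortMoments_le hv.norm_le).trans ?_
    rw [Real.sqrt_mul (by positivity)]
    gcongr
    exact (Real.sqrt_le_left hr).2 hγr
  have short_le (l : ℕ) (hl : l < Fintype.card (ι ⊕ ι)) (u : Fin l → E) :
      |(γ.diff γ').moment u| ≤ N ^ N * (η * (√N.factorial * r)) * ∏ p, ‖u p‖ := by
    have split : (γ.diff γ').moment u = (γ.diff γ₀).moment u - (γ'.diff γ₀).moment u := by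
      simp only [moment_diff, sub_sub_sub_cancel_right]
    rw [← hN] at hl
    have pow_le : (N : ℝ) ^ l * (l + 1) ≤ N ^ N := by
      calc (N : ℝ) ^ l * (l + 1) ≤ N ^ (N - 1) * N := by
            gcongr
            · exact_mod_cast (Nat.zero_le l).trans_lt hl
            · lia
            · exact_mod_cast hl
        _ = N ^ N := pow_sub_one_mul (by lia) _
    rw [split]
    calc _ ≤ _ := abs_moment_sub_moment_le hv hv' moment_bound hη hMη hl u
      _ = N ^ l * (l + 1) * (η * (√N.factorial * r)) * ∏ p, ‖u p‖ := by rw [hN]; ring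
      _ ≤ _ := by gcongr
  refine (energy_le (by positivity) (by positivity) fun l =>
    abs_moment_le hR (by positivity) (norm_atom_diff_le hγ hγ') short_le).trans_eq ?_
  have exp_sq := Real.exp_nat_mul (N * (1 + 2 * R) ^ 2 / 2) 2
  rw [Nat.cast_ofNat, mul_div_cancel₀ _ two_ne_zero] at exp_sq
  rw [decodingConst, ← hN, exp_sq]
  ring

theorem finrank_frame_prod_moments_le [FiniteDimensional ℝ E] {N : ℕ} (hN : N = Fintype.card κ) :
    Module.finrank ℝ ((κ → E) × ((Σ l : Fin N, Fin l → κ) → ℝ))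
      ≤ N * Module.finrank ℝ E + N ^ N := by
  rw [Module.finrank_prod, Module.finrank_pi_fintype, Module.finrank_fintype_fun_eq_card]
  simp only [Finset.sum_const, Finset.card_univ, smul_eq_mul, Fintype.card_sigma,
    Fintype.card_fun, Fintype.card_fin, ← hN]
  exact Nat.add_le_add_left (sum_pow_le_pow_self N) _

theorem card_packing_le [FiniteDimensional ℝ E] {γ₀ : AtomicMeasure ι E} (hR : 0 ≤ R)
    (S : Finset (AtomicMeasure ι E)) (hS : ∀ γ ∈ S, ∀ i, ‖γ.atom i‖ ≤ R) {ε r : ℝ} (hε : 0 < ε)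
    (hεr : ε ≤ r) (hSr : ∀ γ ∈ S, γ.sqDist γ₀ ≤ r ^ 2)
    (hSε : (S : Set (AtomicMeasure ι E)).Pairwise fun γ γ' => ε ^ 2 ≤ γ.sqDist γ')
    {N : ℕ} (hN : N = Fintype.card (ι ⊕ ι)) :
    (S.card : ℝ) ≤ (6 * decodingConst R N * (r / ε)) ^ (N * Module.finrank ℝ E + N ^ N) := by
  have hr : 0 < r := hε.trans_le hεr
  have G_ge_one := one_le_decodingConst R N
  set G := decodingConst R N
  let η := ε / r / (2 * G)
  have η_pos : 0 < η := div_pos (div_pos hε hr) (by linarith)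
  have M_pos : 0 < √N.factorial * r := by positivity
  choose v hv using fun γ : AtomicMeasure ι E => exists_isParsevalFrame (γ.diff γ₀).atom
  let code (γ : AtomicMeasure ι E) : (ι ⊕ ι → E) × ((Σ l : Fin N, Fin l → ι ⊕ ι) → ℝ) :=
    (v γ, (√N.factorial * r)⁻¹ • (γ.diff γ₀).shortMoments (v γ) N)
  have code_le (γ) (hγ : γ ∈ S) : ‖code γ‖ ≤ 1 := by
    refine max_le (hv γ).norm_le ?_
    rw [norm_smul, norm_inv, Real.norm_of_nonneg M_pos.le, inv_mul_le_one₀ M_pos]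
    refine (norm_shortMoments_le (hv γ).norm_le).trans ?_
    rw [Real.sqrt_mul (by positivity)]
    gcongr
    exact (Real.sqrt_le_left hr.le).2 (hSr γ hγ)
  have code_separated : (S : Set _).Pairwise fun γ γ' => η ≤ dist (code γ) (code γ') := by
    intro γ hγ γ' hγ' hne
    by_contra! hlt
    rw [dist_eq_norm] at hlt
    have close_moments := (norm_snd_le _).trans hlt.le
    rw [Prod.snd_sub, ← smul_sub, norm_smul, norm_inv, Real.norm_of_nonneg M_pos.le,
      inv_mul_le_iff₀ M_pos, mul_comm] at close_moments
    have := (hSε hγ hγ' hne).trans (sqDist_le_of_shortMoments_close hR (hS γ hγ) (hS γ' hγ') hN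
      hr.le (hSr γ hγ) (hv γ) (hv γ') ((norm_fst_le _).trans hlt.le) close_moments)
    have half : G * (η * r) = ε / 2 := by
      simp only [η]
      field_simp
    rw [half] at this
    nlinarith
  have base_le : 1 + 2 / η ≤ 6 * G * (r / ε) := by
    have : 2 / η = 4 * (G * (r / ε)) := by
      simp only [η]
      field_simp
      norm_num
    linarith [one_le_mul_of_one_le_of_one_le G_ge_one ((one_le_div hε).2 hεr)]
  calc (S.card : ℝ) ≤ (1 + 2 / η) ^ _ := card_le_of_separated η_pos S code code_le code_separated
    _ ≤ (1 + 2 / η) ^ (N * Module.finrank ℝ E + N ^ N) :=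
      pow_le_pow_right₀ (le_add_of_nonneg_right (by positivity)) (finrank_frame_prod_moments_le hN)
    _ ≤ _ := by gcongr

end AtomicMeasure

end

section PositiveDensity

theorem sq_sqrt_sub_sqrt_le_add {a b : ℝ} (ha : 0 ≤ a) (hb : 0 ≤ b) : (√a - √b) ^ 2 ≤ a + b := by
  nlinarith [Real.sq_sqrt ha, Real.sq_sqrt hb, mul_nonneg (Real.sqrt_nonneg a) (Real.sqrt_nonneg b)]

theorem sq_sqrt_sub_sqrt_le_div {a b : ℝ} (ha : 0 ≤ a) (hb : 0 < b) :
    (√a - √b) ^ 2 ≤ (a - b) ^ 2 / b := by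
  rw [le_div_iff₀ hb, ← Real.sq_sqrt ha]
  nth_rw 2 3 [← Real.sq_sqrt hb.le]
  rw [sq_sub_sq, Real.sqrt_sq (Real.sqrt_nonneg a), mul_pow, mul_comm]
  gcongr
  linarith [Real.sqrt_nonneg a]

theorem sq_sub_le_sq_sqrt_sub_sqrt {a b K : ℝ} (ha : 0 ≤ a) (hb : 0 ≤ b) (hK : 0 < K) :
    (a - b) ^ 2 ≤ 2 * K * (√a - √b) ^ 2 + (a - b) ^ 2 * (a + b) / (4 * K) := by
  obtain ⟨s, hs, rfl⟩ : ∃ s, 0 ≤ s ∧ s ^ 2 = a := ⟨√a, Real.sqrt_nonneg a, Real.sq_sqrt ha⟩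
  obtain ⟨t, ht, rfl⟩ : ∃ t, 0 ≤ t ∧ t ^ 2 = b := ⟨√b, Real.sqrt_nonneg b, Real.sq_sqrt hb⟩
  rw [Real.sqrt_sq hs, Real.sqrt_sq ht, ← sub_nonneg]
  have : 0 ≤ ((4 * K * (s - t) - (s ^ 2 - t ^ 2) * (s + t)) ^ 2
      + ((s ^ 2 - t ^ 2) * (s - t)) ^ 2) / (8 * K) := by positivity
  refine this.trans_eq ?_
  field_simp
  ring

theorem mul_sqrt_div_le {a b c : ℝ} (ha : 0 ≤ a) (hb : 0 < b) :
    c * √(a / b) ≤ c + (a - b) / 2 + ((c - b) ^ 2 / b - (√a - √b) ^ 2 / 4) := by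
  obtain ⟨s, hs, rfl⟩ : ∃ s, 0 ≤ s ∧ s ^ 2 = a := ⟨√a, Real.sqrt_nonneg a, Real.sq_sqrt ha⟩
  obtain ⟨t, ht, rfl⟩ : ∃ t, 0 < t ∧ t ^ 2 = b := ⟨√b, Real.sqrt_pos.2 hb, Real.sq_sqrt hb.le⟩
  rw [Real.sqrt_div' _ (sq_nonneg t), Real.sqrt_sq hs, Real.sqrt_sq ht.le, ← sub_nonneg]
  refine (sq_nonneg ((c - t ^ 2) / t - (s - t) / 2)).trans_eq ?_
  field_simp
  ring

variable {Ω : Type*} [MeasurableSpace Ω]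

/-- Everywhere positive probability densities with respect to `ν`. -/
structure IsPosDensity (ν : Measure Ω) (p : Ω → ℝ) : Prop where
  measurable : Measurable p
  pos : ∀ x, 0 < p x
  integrable : Integrable p ν
  integral_eq_one : ∫ x, p x ∂ν = 1

/-- The measure with the real density `p` with respect to `ν`. -/
def densityMeasure (ν : Measure Ω) (p : Ω → ℝ) : Measure Ω :=
  ν.withDensity fun x => ENNReal.ofReal (p x)

/-- The squared Hellinger distance of two densities with respect to `ν`. -/
def sqHellinger (ν : Measure Ω) (p q : Ω → ℝ) : ℝ := ∫ x, (√(p x) - √(q x)) ^ 2 ∂ν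

/-- The `χ²`-divergence of two densities with respect to `ν`. -/
def chiSq (ν : Measure Ω) (p q : Ω → ℝ) : ℝ := ∫ x, (p x - q x) ^ 2 / q x ∂ν

variable {ν : Measure Ω} {p q r : Ω → ℝ}

theorem sqHellinger_nonneg (ν : Measure Ω) (p q : Ω → ℝ) : 0 ≤ sqHellinger ν p q :=
  integral_nonneg fun _ => sq_nonneg _

theorem sqHellinger_comm (ν : Measure Ω) (p q : Ω → ℝ) :
    sqHellinger ν p q = sqHellinger ν q p := by
  simp only [sqHellinger, sub_sq_comm]

theorem integral_densityMeasure (hp : Measurable p) (hp₀ : ∀ x, 0 ≤ p x) (f : Ω → ℝ) :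
    ∫ x, f x ∂(densityMeasure ν p) = ∫ x, p x * f x ∂ν := by
  rw [densityMeasure, integral_withDensity_eq_integral_toReal_smul hp.ennreal_ofReal
    (ae_of_all _ fun _ => ENNReal.ofReal_lt_top)]
  simp only [ENNReal.toReal_ofReal (hp₀ _), smul_eq_mul]

theorem integrable_densityMeasure_iff (hp : Measurable p) (hp₀ : ∀ x, 0 ≤ p x) {f : Ω → ℝ} :
    Integrable f (densityMeasure ν p) ↔ Integrable (fun x => p x * f x) ν := by
  rw [densityMeasure, integrable_withDensity_iff_integrable_smul' hp.ennreal_ofReal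
    (ae_of_all _ fun _ => ENNReal.ofReal_lt_top)]
  simp only [ENNReal.toReal_ofReal (hp₀ _), smul_eq_mul]

theorem rnDeriv_densityMeasure [SigmaFinite (densityMeasure ν q)] (hp : Measurable p)
    (hp₀ : ∀ x, 0 ≤ p x) (hq : Measurable q) (hq₀ : ∀ x, 0 < q x) :
    (fun x => ((densityMeasure ν p).rnDeriv (densityMeasure ν q) x).toReal)
      =ᵐ[densityMeasure ν q] fun x => p x / q x := by
  have ratio_measurable : Measurable fun x => p x / q x := hp.div hq
  have chain : densityMeasure ν p = (densityMeasure ν q).withDensity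
      fun x => ENNReal.ofReal (p x / q x) := by
    rw [densityMeasure, densityMeasure,
      ← withDensity_mul _ hq.ennreal_ofReal ratio_measurable.ennreal_ofReal]
    congr 1 with x
    rw [Pi.mul_apply, ← ENNReal.ofReal_mul (hq₀ x).le, mul_div_cancel₀ _ (hq₀ x).ne']
  rw [chain]
  filter_upwards [Measure.rnDeriv_withDensity (densityMeasure ν q) ratio_measurable.ennreal_ofReal]
    with x hx
  rw [hx, ENNReal.toReal_ofReal (div_nonneg (hp₀ x) (hq₀ x).le)]

namespace IsPosDensity

theorem nonneg (hp : IsPosDensity ν p) (x : Ω) : 0 ≤ p x := (hp.pos x).le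

theorem isProbabilityMeasure (hp : IsPosDensity ν p) :
    IsProbabilityMeasure (densityMeasure ν p) := by
  refine ⟨?_⟩
  rw [densityMeasure, withDensity_apply _ MeasurableSet.univ, Measure.restrict_univ,
    ← ofReal_integral_eq_lintegral_ofReal hp.integrable (ae_of_all _ hp.nonneg),
    hp.integral_eq_one, ENNReal.ofReal_one]

theorem hellinger_eq (hp : IsPosDensity ν p) (hq : IsPosDensity ν q) :
    hellinger (densityMeasure ν p) (densityMeasure ν q) = √(sqHellinger ν p q) := by
  have sum_eq : densityMeasure ν p + densityMeasure ν q = densityMeasure ν fun x => p x + q x := by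
    rw [densityMeasure, densityMeasure, ← withDensity_add_left hp.measurable.ennreal_ofReal]
    congr 1 with x
    rw [Pi.add_apply, ENNReal.ofReal_add (hp.nonneg x) (hq.nonneg x)]
  have sum_pos (x) : 0 < p x + q x := add_pos (hp.pos x) (hq.pos x)
  have sum_measurable : Measurable fun x => p x + q x := hp.measurable.add hq.measurable
  have := hp.isProbabilityMeasure
  have := hq.isProbabilityMeasure
  have : SigmaFinite (densityMeasure ν fun x => p x + q x) := sum_eq ▸ inferInstance
  rw [hellinger, sqHellinger, sum_eq]
  congr 1
  calc _ = ∫ x, (√(p x / (p x + q x)) - √(q x / (p x + q x))) ^ 2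
          ∂(densityMeasure ν fun x => p x + q x) := by
        refine integral_congr_ae ?_
        filter_upwards [rnDeriv_densityMeasure hp.measurable hp.nonneg sum_measurable sum_pos,
          rnDeriv_densityMeasure hq.measurable hq.nonneg sum_measurable sum_pos] with x hpx hqx
        rw [hpx, hqx]
    _ = _ := by
        rw [integral_densityMeasure sum_measurable fun x => (sum_pos x).le]
        refine integral_congr_ae (ae_of_all _ fun x => ?_)
        simp only [Real.sqrt_div (hp.nonneg x), Real.sqrt_div (hq.nonneg x), ← sub_div, div_pow,
          Real.sq_sqrt (sum_pos x).le, mul_div_cancel₀ _ (sum_pos x).ne']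

theorem integrable_sq_sqrt_sub (hp : IsPosDensity ν p) (hq : IsPosDensity ν q) :
    Integrable (fun x => (√(p x) - √(q x)) ^ 2) ν := by
  refine (hp.integrable.add hq.integrable).mono'
    ((hp.measurable.sqrt.sub hq.measurable.sqrt).pow_const 2).aestronglyMeasurable
    (ae_of_all _ fun x => ?_)
  rw [Real.norm_of_nonneg (sq_nonneg _)]
  exact sq_sqrt_sub_sqrt_le_add (hp.nonneg x) (hq.nonneg x)

theorem sqHellinger_le_two (hp : IsPosDensity ν p) (hq : IsPosDensity ν q) :
    sqHellinger ν p q ≤ 2 :=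
  calc sqHellinger ν p q ≤ ∫ x, (p x + q x) ∂ν :=
        integral_mono (hp.integrable_sq_sqrt_sub hq) (hp.integrable.add hq.integrable)
          fun x => sq_sqrt_sub_sqrt_le_add (hp.nonneg x) (hq.nonneg x)
    _ = 2 := by
        rw [integral_add hp.integrable hq.integrable, hp.integral_eq_one, hq.integral_eq_one,
          one_add_one_eq_two]

theorem sqHellinger_triangle (hp : IsPosDensity ν p) (hq : IsPosDensity ν q)
    (hr : IsPosDensity ν r) :
    sqHellinger ν p r ≤ 2 * sqHellinger ν p q + 2 * sqHellinger ν q r := by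
  have hpq := (hp.integrable_sq_sqrt_sub hq).const_mul 2
  have hqr := (hq.integrable_sq_sqrt_sub hr).const_mul 2
  unfold sqHellinger
  rw [← integral_const_mul, ← integral_const_mul, ← integral_add hpq hqr]
  refine integral_mono (hp.integrable_sq_sqrt_sub hr) (hpq.add hqr) fun x => ?_
  nlinarith [sq_nonneg ((√(p x) - √(q x)) - (√(q x) - √(r x)))]

theorem sqHellinger_le_chiSq (hp : IsPosDensity ν p) (hq : IsPosDensity ν q)
    (hpq : Integrable (fun x => (p x - q x) ^ 2 / q x) ν) : sqHellinger ν p q ≤ chiSq ν p q :=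
  integral_mono (hp.integrable_sq_sqrt_sub hq) hpq
    fun x => sq_sqrt_sub_sqrt_le_div (hp.nonneg x) (hq.pos x)

theorem integral_sq_sub_le_mul_sqHellinger (hp : IsPosDensity ν p) (hq : IsPosDensity ν q) {K : ℝ}
    (hK : 0 < K) (hpq : Integrable (fun x => (p x - q x) ^ 2) ν)
    (hpq' : Integrable (fun x => (p x - q x) ^ 2 * (p x + q x)) ν)
    (h : ∫ x, (p x - q x) ^ 2 * (p x + q x) ∂ν ≤ 2 * K * ∫ x, (p x - q x) ^ 2 ∂ν) :
    ∫ x, (p x - q x) ^ 2 ∂ν ≤ 4 * K * sqHellinger ν p q := by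
  have hell := (hp.integrable_sq_sqrt_sub hq).const_mul (2 * K)
  have pointwise := integral_mono hpq (hell.add (hpq'.div_const (4 * K)))
    fun x => sq_sub_le_sq_sqrt_sub_sqrt (hp.nonneg x) (hq.nonneg x) hK
  simp only [Pi.add_apply] at pointwise
  rw [integral_add hell (hpq'.div_const _), integral_const_mul, integral_div] at pointwise
  have half : (∫ x, (p x - q x) ^ 2 * (p x + q x) ∂ν) / (4 * K)
      ≤ (∫ x, (p x - q x) ^ 2 ∂ν) / 2 := by
    rw [div_le_div_iff₀ (by positivity) two_pos]
    linarith
  unfold sqHellinger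
  linarith

theorem integrable_mul_sqrt_div (hp : IsPosDensity ν p) (hq : IsPosDensity ν q)
    (hr : IsPosDensity ν r) (hpq : Integrable (fun x => (p x - q x) ^ 2 / q x) ν) :
    Integrable (fun x => p x * √(r x / q x)) ν := by
  refine ((hp.integrable.add ((hr.integrable.sub hq.integrable).div_const 2)).add
    (hpq.sub ((hr.integrable_sq_sqrt_sub hq).div_const 4))).mono'
    (hp.measurable.mul (hr.measurable.div hq.measurable).sqrt).aestronglyMeasurable
    (ae_of_all _ fun x => ?_)
  rw [Real.norm_of_nonneg (mul_nonneg (hp.nonneg x) (Real.sqrt_nonneg _))]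
  exact mul_sqrt_div_le (hr.nonneg x) (hq.pos x)

theorem integral_mul_sqrt_div_le (hp : IsPosDensity ν p) (hq : IsPosDensity ν q)
    (hr : IsPosDensity ν r) (hpq : Integrable (fun x => (p x - q x) ^ 2 / q x) ν) :
    ∫ x, p x * √(r x / q x) ∂ν ≤ 1 + (chiSq ν p q - sqHellinger ν r q / 4) := by
  have mass : Integrable (fun x => (r x - q x) / 2) ν :=
    (hr.integrable.sub hq.integrable).div_const 2
  have hell : Integrable (fun x => (√(r x) - √(q x)) ^ 2 / 4) ν :=
    (hr.integrable_sq_sqrt_sub hq).div_const 4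
  have first : Integrable (fun x => p x + (r x - q x) / 2) ν := hp.integrable.add mass
  have second : Integrable (fun x => (p x - q x) ^ 2 / q x - (√(r x) - √(q x)) ^ 2 / 4) ν :=
    hpq.sub hell
  refine (integral_mono (hp.integrable_mul_sqrt_div hq hr hpq) (first.add second)
    fun x => mul_sqrt_div_le (hr.nonneg x) (hq.pos x)).trans_eq ?_
  simp only [Pi.add_apply]
  rw [integral_add first second, integral_add hp.integrable mass,
    integral_sub hpq hell, integral_div, integral_div, integral_sub hr.integrable hq.integrable,
    hp.integral_eq_one, hq.integral_eq_one, hr.integral_eq_one, sub_self, zero_div, add_zero,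
    chiSq, sqHellinger]

/- Markov's inequality for the square root of the likelihood ratio of `r` and `q`. -/
theorem pi_likelihood_le (hp : IsPosDensity ν p) (hq : IsPosDensity ν q)
    (hr : IsPosDensity ν r) (hpq : Integrable (fun x => (p x - q x) ^ 2 / q x) ν) (n : ℕ) :
    Measure.pi (fun _ : Fin n => densityMeasure ν p) {x | ∏ i, q (x i) ≤ ∏ i, r (x i)}
      ≤ ENNReal.ofReal (Real.exp (n * (chiSq ν p q - sqHellinger ν r q / 4))) := by
  have := hp.isProbabilityMeasure
  let g (x : Ω) : ℝ := √(r x / q x)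
  have g_measurable : Measurable g := (hr.measurable.div hq.measurable).sqrt
  have g_integrable : Integrable g (densityMeasure ν p) :=
    (integrable_densityMeasure_iff hp.measurable hp.nonneg).2
      (hp.integrable_mul_sqrt_div hq hr hpq)
  have integral_g_le : ∫ x, g x ∂(densityMeasure ν p)
      ≤ 1 + (chiSq ν p q - sqHellinger ν r q / 4) := by
    rw [integral_densityMeasure hp.measurable hp.nonneg]
    exact hp.integral_mul_sqrt_div_le hq hr hpq
  have subset : {x : Fin n → Ω | ∏ i, q (x i) ≤ ∏ i, r (x i)}
      ⊆ {x | 1 ≤ ENNReal.ofReal (∏ i, g (x i))} := by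
    intro x hx
    have prod_g : ∏ i, g (x i) = √((∏ i, r (x i)) / ∏ i, q (x i)) := by
      rw [← Finset.prod_div_distrib, Real.sqrt_prod _ fun i _ =>
        div_nonneg (hr.nonneg (x i)) (hq.nonneg (x i))]
    simpa [prod_g, one_le_div (Finset.prod_pos fun i _ => hq.pos (x i))] using hx
  calc _ ≤ Measure.pi (fun _ : Fin n => densityMeasure ν p)
          {x | 1 ≤ ENNReal.ofReal (∏ i, g (x i))} := measure_mono subset
    _ ≤ ∫⁻ x, ENNReal.ofReal (∏ i, g (x i)) ∂(Measure.pi fun _ : Fin n => densityMeasure ν p) := by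
        simpa using mul_meas_ge_le_lintegral (μ := Measure.pi fun _ : Fin n => densityMeasure ν p)
          (Finset.measurable_prod _ fun i _ =>
            g_measurable.comp (measurable_pi_apply i)).ennreal_ofReal 1
    _ = ENNReal.ofReal ((∫ x, g x ∂(densityMeasure ν p)) ^ n) := by
        rw [← ofReal_integral_eq_lintegral_ofReal (Integrable.fintype_prod fun _ => g_integrable)
          (ae_of_all _ fun x => Finset.prod_nonneg fun i _ => Real.sqrt_nonneg _),
          integral_fintype_prod_eq_pow, Fintype.card_fin]
    _ ≤ _ := by
        have g_nonneg : 0 ≤ ∫ x, g x ∂(densityMeasure ν p) :=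
          integral_nonneg fun _ => Real.sqrt_nonneg _
        refine ENNReal.ofReal_le_ofReal ((pow_le_pow_left₀ g_nonneg integral_g_le n).trans ?_)
        rw [Real.exp_nat_mul]
        exact pow_le_pow_left₀ (g_nonneg.trans integral_g_le) (by
          rw [add_comm]
          exact Real.add_one_le_exp _) n

end IsPosDensity

end PositiveDensity

section ShiftDensity

variable {E : Type*} [NormedAddCommGroup E] [InnerProductSpace ℝ E]

/-- The density of `N(m, I)` with respect to `N(0, I)`. -/
def shiftDensity (m x : E) : ℝ := Real.exp (⟪m, x⟫ - ‖m‖ ^ 2 / 2)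

theorem shiftDensity_pos (m x : E) : 0 < shiftDensity m x := Real.exp_pos _

theorem shiftDensity_mul_shiftDensity (a b z x : E) :
    shiftDensity a x * shiftDensity b x * shiftDensity z x
      = Real.exp (-((‖a‖ ^ 2 + ‖b‖ ^ 2 + ‖z‖ ^ 2) / 2)) * Real.exp ⟪a + b + z, x⟫ := by
  simp only [shiftDensity, ← Real.exp_add, inner_add_left]
  congr 1
  ring

theorem inv_shiftDensity (m x : E) :
    (shiftDensity m x)⁻¹ = Real.exp (‖m‖ ^ 2) * shiftDensity (-m) x := by
  rw [shiftDensity, shiftDensity, ← Real.exp_neg, ← Real.exp_add, inner_neg_left, norm_neg]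
  congr 1
  ring

variable [FiniteDimensional ℝ E] [MeasurableSpace E] [BorelSpace E]

theorem integral_cexp_inner_stdGaussian (m t : E) :
    ∫ x, Complex.exp (⟪x, m⟫ + ⟪x, t⟫ * Complex.I) ∂(stdGaussian E)
      = Complex.exp ((‖m‖ ^ 2 - ‖t‖ ^ 2) / 2 + ⟪m, t⟫ * Complex.I) := by
  let b := stdOrthonormalBasis ℝ E
  let c (i : Fin (Module.finrank ℝ E)) : ℂ := ⟪b i, m⟫ + ⟪b i, t⟫ * Complex.I
  have factorization (x : Fin (Module.finrank ℝ E) → ℝ) :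
      Complex.exp (⟪∑ i, x i • b i, m⟫ + ⟪∑ i, x i • b i, t⟫ * Complex.I)
        = ∏ i, Complex.exp (c i * x i) := by
    rw [← Complex.exp_sum]
    congr 1
    simp only [sum_inner, real_inner_smul_left, Complex.ofReal_sum, Complex.ofReal_mul,
      Finset.sum_mul, ← Finset.sum_add_distrib]
    exact Finset.sum_congr rfl fun i _ => by ring
  have one_dimensional (z : ℂ) :
      ∫ x : ℝ, Complex.exp (z * x) ∂(gaussianReal 0 1) = Complex.exp (z ^ 2 / 2) := by
    simpa [complexMGF] using complexMGF_id_gaussianReal (μ := 0) (v := 1) z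
  have sum_sq : ∑ i, c i ^ 2 / 2 = (‖m‖ ^ 2 - ‖t‖ ^ 2) / 2 + ⟪m, t⟫ * Complex.I := by
    rw [← Complex.ofReal_pow, ← Complex.ofReal_pow, ← b.sum_sq_inner_right m,
      ← b.sum_sq_inner_right t, ← b.sum_inner_mul_inner m t]
    push_cast
    rw [← Finset.sum_sub_distrib, Finset.sum_div, Finset.sum_mul, ← Finset.sum_add_distrib]
    refine Finset.sum_congr rfl fun i _ => ?_
    rw [real_inner_comm (b i) m]
    linear_combination (⟪b i, t⟫ : ℂ) ^ 2 / 2 * Complex.I_sq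
  rw [stdGaussian, integral_map (Measurable.aemeasurable (by fun_prop))
    (Measurable.aestronglyMeasurable (by fun_prop)), integral_congr_ae (ae_of_all _ factorization),
    integral_fintype_prod_eq_prod (f := fun i (x : ℝ) => Complex.exp (c i * x))]
  simp only [one_dimensional]
  rw [← Complex.exp_sum, sum_sq]

theorem integrable_exp_inner_stdGaussian (a : E) :
    Integrable (fun x => Real.exp ⟪a, x⟫) (stdGaussian E) := by
  have map_inner : (stdGaussian E).map (innerSL ℝ a) = gaussianReal 0 (‖a‖ ^ 2).toNNReal := by
    rw [IsGaussian.map_eq_gaussianReal, integral_strongDual_stdGaussian,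
      variance_dual_stdGaussian, innerSL_apply_norm]
  have : Integrable (fun y : ℝ => Real.exp (1 * y)) ((stdGaussian E).map (innerSL ℝ a)) :=
    map_inner ▸ integrable_exp_mul_gaussianReal 1
  simpa [Function.comp_def] using this.comp_measurable (innerSL ℝ a).continuous.measurable

theorem integral_exp_inner_stdGaussian (a : E) :
    ∫ x, Real.exp ⟪a, x⟫ ∂(stdGaussian E) = Real.exp (‖a‖ ^ 2 / 2) := by
  apply Complex.ofReal_injective
  rw [← integral_complex_ofReal]
  simpa [real_inner_comm a] using integral_cexp_inner_stdGaussian a 0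

theorem isPosDensity_shiftDensity (m : E) : IsPosDensity (stdGaussian E) (shiftDensity m) where
  measurable := by
    unfold shiftDensity
    fun_prop
  pos := shiftDensity_pos m
  integrable := by
    unfold shiftDensity
    simp only [Real.exp_sub]
    exact (integrable_exp_inner_stdGaussian m).div_const _
  integral_eq_one := by
    simp only [shiftDensity, Real.exp_sub, integral_div, integral_exp_inner_stdGaussian]
    exact div_self (Real.exp_pos _).ne'

theorem map_add_stdGaussian (m : E) :
    (stdGaussian E).map (fun x => m + x) = densityMeasure (stdGaussian E) (shiftDensity m) := by
  have := (isPosDensity_shiftDensity m).isProbabilityMeasure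
  refine Measure.ext_of_charFun (funext fun t => ?_)
  have translated (x : E) : Complex.exp (⟪m + x, t⟫ * Complex.I)
      = Complex.exp (⟪m, t⟫ * Complex.I) * Complex.exp (⟪x, (0 : E)⟫ + ⟪x, t⟫ * Complex.I) := by
    rw [← Complex.exp_add, inner_add_left, inner_zero_right]
    congr 1
    push_cast
    ring
  have reweighted (x : E) : shiftDensity m x • Complex.exp (⟪x, t⟫ * Complex.I)
      = Complex.exp (-(‖m‖ ^ 2 / 2)) * Complex.exp (⟪x, m⟫ + ⟪x, t⟫ * Complex.I) := by
    rw [shiftDensity, Complex.real_smul, Complex.ofReal_exp, ← Complex.exp_add, ← Complex.exp_add,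
      real_inner_comm]
    congr 1
    push_cast
    ring
  rw [charFun_apply, charFun_apply, integral_map (by fun_prop) (by fun_prop), densityMeasure,
    integral_withDensity_eq_integral_toReal_smul
      (isPosDensity_shiftDensity m).measurable.ennreal_ofReal
      (ae_of_all _ fun _ => ENNReal.ofReal_lt_top)]
  simp only [ENNReal.toReal_ofReal (shiftDensity_pos m _).le, translated, reweighted]
  rw [integral_const_mul, integral_const_mul, integral_cexp_inner_stdGaussian,
    integral_cexp_inner_stdGaussian, ← Complex.exp_add, ← Complex.exp_add]
  congr 1
  simp only [norm_zero, inner_zero_left, Complex.ofReal_zero]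
  ring

theorem integrable_shiftDensity_mul (a b z : E) :
    Integrable (fun x => shiftDensity a x * shiftDensity b x * shiftDensity z x)
      (stdGaussian E) := by
  simp only [shiftDensity_mul_shiftDensity]
  exact (integrable_exp_inner_stdGaussian _).const_mul _

theorem integral_shiftDensity_mul (a b z : E) :
    ∫ x, shiftDensity a x * shiftDensity b x * shiftDensity z x ∂(stdGaussian E)
      = Real.exp (⟪a, b⟫ + ⟪a, z⟫ + ⟪b, z⟫) := by
  simp only [shiftDensity_mul_shiftDensity]
  rw [integral_const_mul, integral_exp_inner_stdGaussian, ← Real.exp_add]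
  congr 1
  simp only [← real_inner_self_eq_norm_sq, inner_add_left, inner_add_right,
    real_inner_comm a b, real_inner_comm a z, real_inner_comm b z]
  ring

end ShiftDensity

namespace AtomicMeasure

variable {ι κ E : Type*}

/-- `γ` is a probability measure with atoms in the ball of radius `R`. -/
structure IsMixing [Fintype ι] [Norm E] (R : ℝ) (γ : AtomicMeasure ι E) : Prop where
  norm_atom_le : ∀ i, ‖γ.atom i‖ ≤ R
  weight_nonneg : ∀ i, 0 ≤ γ.weight i
  sum_weight : ∑ i, γ.weight i = 1

/-- The image of an atomic measure under `x ↦ -x`. -/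
def reflect [Neg E] (γ : AtomicMeasure ι E) : AtomicMeasure ι E where
  weight := γ.weight
  atom := -γ.atom

variable [Fintype ι] [Fintype κ] {R : ℝ} {γ : AtomicMeasure ι E} {γ' : AtomicMeasure κ E}

theorem IsMixing.integral_le [Norm E] (h : γ.IsMixing R) {f : E → ℝ} {c : ℝ}
    (hf : ∀ z, ‖z‖ ≤ R → f z ≤ c) : γ.integral f ≤ c :=
  calc γ.integral f ≤ ∑ i, γ.weight i * c := Finset.sum_le_sum fun i _ =>
        mul_le_mul_of_nonneg_left (hf _ (h.norm_atom_le i)) (h.weight_nonneg i)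
    _ = c := by rw [← Finset.sum_mul, h.sum_weight, one_mul]

theorem IsMixing.reflect [SeminormedAddCommGroup E] (h : γ.IsMixing R) : γ.reflect.IsMixing R where
  norm_atom_le i := (norm_neg _).trans_le (h.norm_atom_le i)
  weight_nonneg := h.weight_nonneg
  sum_weight := h.sum_weight

theorem exists_isMixing [Nonempty ι] [SeminormedAddCommGroup E] (hR : 0 ≤ R) :
    ∃ γ : AtomicMeasure ι E, γ.IsMixing R := by
  classical
  obtain ⟨i⟩ := ‹Nonempty ι›
  exact ⟨⟨Pi.single i 1, 0⟩, fun _ => by simpa using hR,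
    (Pi.single_nonneg.2 zero_le_one : (0 : ι → ℝ) ≤ Pi.single i 1), by simp⟩

theorem integrable_integral {Ω : Type*} [MeasurableSpace Ω] {ν : Measure Ω} {f : E → Ω → ℝ}
    (hf : ∀ a, Integrable (f a) ν) : Integrable (fun x => γ.integral fun a => f a x) ν :=
  integrable_finsetSum _ fun _ _ => (hf _).const_mul _

theorem integral_integral {Ω : Type*} [MeasurableSpace Ω] {ν : Measure Ω} {f : E → Ω → ℝ}
    (hf : ∀ a, Integrable (f a) ν) :
    ∫ x, (γ.integral fun a => f a x) ∂ν = γ.integral fun a => ∫ x, f a x ∂ν := by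
  unfold integral
  rw [MeasureTheory.integral_finsetSum _ fun _ _ => (hf _).const_mul _]
  simp only [MeasureTheory.integral_const_mul]

variable [NormedAddCommGroup E] [InnerProductSpace ℝ E]

/-- The density of a Gaussian mixture with respect to the standard Gaussian measure. -/
def density (γ : AtomicMeasure ι E) (x : E) : ℝ := γ.integral fun m => shiftDensity m x

theorem density_diff (γ : AtomicMeasure ι E) (γ' : AtomicMeasure κ E) (x : E) :
    (γ.diff γ').density x = γ.density x - γ'.density x :=
  integral_diff _ _ _

theorem IsMixing.inv_density_le (h : γ.IsMixing R) (x : E) :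
    (γ.density x)⁻¹ ≤ Real.exp (R ^ 2) * γ.reflect.density x := by
  have convex : ConvexOn ℝ (Set.Ioi (0 : ℝ)) fun t : ℝ => t⁻¹ := by
    simpa using convexOn_zpow (𝕜 := ℝ) (-1)
  have jensen := convex.map_sum_le (t := Finset.univ) (w := γ.weight)
    (p := fun i => shiftDensity (γ.atom i) x) (fun i _ => h.weight_nonneg i) h.sum_weight
    fun i _ => shiftDensity_pos _ _
  refine jensen.trans ?_
  rw [density, ← integral_const_mul]
  refine Finset.sum_le_sum fun i _ => mul_le_mul_of_nonneg_left ?_ (h.weight_nonneg i)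
  rw [inv_shiftDensity]
  exact mul_le_mul_of_nonneg_right
    (Real.exp_le_exp.2 (pow_le_pow_left₀ (norm_nonneg _) (h.norm_atom_le i) 2))
    (shiftDensity_pos _ _).le

theorem sq_density_mul_shiftDensity (γ : AtomicMeasure ι E) (z x : E) :
    γ.density x ^ 2 * shiftDensity z x = γ.integral fun a => γ.integral fun b =>
      shiftDensity a x * shiftDensity b x * shiftDensity z x := by
  simp only [sq, density, integral, Finset.sum_mul, Finset.mul_sum]
  exact Finset.sum_congr rfl fun i _ => Finset.sum_congr rfl fun j _ => by ring

theorem sq_density_mul_density (γ : AtomicMeasure ι E) (γ' : AtomicMeasure κ E) (x : E) :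
    γ.density x ^ 2 * γ'.density x
      = γ'.integral fun z => γ.density x ^ 2 * shiftDensity z x :=
  (integral_const_mul _ _ _).symm

theorem IsMixing.sq_density_div_density_le (h' : γ'.IsMixing R) (x : E) :
    γ.density x ^ 2 / γ'.density x
      ≤ Real.exp (R ^ 2) * (γ.density x ^ 2 * γ'.reflect.density x) := by
  rw [div_eq_mul_inv, mul_left_comm]
  exact mul_le_mul_of_nonneg_left (h'.inv_density_le x) (sq_nonneg _)

variable [FiniteDimensional ℝ E] [MeasurableSpace E] [BorelSpace E]

theorem IsMixing.isPosDensity (h : γ.IsMixing R) : IsPosDensity (stdGaussian E) γ.density where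
  measurable := Finset.measurable_sum _ fun i _ =>
    (isPosDensity_shiftDensity (γ.atom i)).measurable.const_mul _
  pos x := by
    obtain ⟨i, -, hi⟩ := Finset.exists_ne_zero_of_sum_ne_zero (h.sum_weight.trans_ne one_ne_zero)
    exact Finset.sum_pos' (fun i _ => mul_nonneg (h.weight_nonneg i) (shiftDensity_pos _ _).le)
      ⟨i, Finset.mem_univ i, mul_pos ((h.weight_nonneg i).lt_of_ne' hi) (shiftDensity_pos _ _)⟩
  integrable := integrable_integral fun a => (isPosDensity_shiftDensity a).integrable
  integral_eq_one := by
    unfold density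
    rw [integral_integral fun a => (isPosDensity_shiftDensity a).integrable]
    simp only [(isPosDensity_shiftDensity _).integral_eq_one, integral, mul_one, h.sum_weight]

theorem integrable_sq_density_mul_shiftDensity (γ : AtomicMeasure ι E) (z : E) :
    Integrable (fun x => γ.density x ^ 2 * shiftDensity z x) (stdGaussian E) := by
  simp only [sq_density_mul_shiftDensity]
  exact integrable_integral fun a => integrable_integral fun b => integrable_shiftDensity_mul a b z

theorem integral_sq_density_mul_shiftDensity (γ : AtomicMeasure ι E) (z : E) :
    ∫ x, γ.density x ^ 2 * shiftDensity z x ∂(stdGaussian E) = (γ.tilt z).energy := by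
  simp only [sq_density_mul_shiftDensity]
  rw [integral_integral fun a => integrable_integral fun b => integrable_shiftDensity_mul a b z,
    energy, tilt, integral_reweight]
  congr 1 with a
  rw [integral_integral fun b => integrable_shiftDensity_mul a b z, integral_reweight,
    ← integral_const_mul]
  congr 1 with b
  rw [integral_shiftDensity_mul, Real.exp_add, Real.exp_add, real_inner_comm z, real_inner_comm z]
  ring

theorem integrable_sq_density (γ : AtomicMeasure ι E) :
    Integrable (fun x => γ.density x ^ 2) (stdGaussian E) := by
  simpa [shiftDensity] using γ.integrable_sq_density_mul_shiftDensity 0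

theorem integral_sq_density (γ : AtomicMeasure ι E) :
    ∫ x, γ.density x ^ 2 ∂(stdGaussian E) = γ.energy := by
  simpa [shiftDensity, tilt, reweight] using γ.integral_sq_density_mul_shiftDensity 0

theorem integrable_sq_density_mul_density (γ : AtomicMeasure ι E) (γ' : AtomicMeasure κ E) :
    Integrable (fun x => γ.density x ^ 2 * γ'.density x) (stdGaussian E) := by
  simp only [sq_density_mul_density]
  exact integrable_integral fun z => γ.integrable_sq_density_mul_shiftDensity z

theorem integral_sq_density_mul_density_le (hR : 0 ≤ R) (hγ : ∀ i, ‖γ.atom i‖ ≤ R)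
    (h' : γ'.IsMixing R) : ∫ x, γ.density x ^ 2 * γ'.density x ∂(stdGaussian E)
      ≤ tiltConst R (Fintype.card ι) * γ.energy := by
  simp only [sq_density_mul_density]
  rw [integral_integral fun z => γ.integrable_sq_density_mul_shiftDensity z]
  simp only [integral_sq_density_mul_shiftDensity]
  exact h'.integral_le fun z hz => energy_tilt_le hR hγ hz

theorem integral_sq_density_sub (γ : AtomicMeasure ι E) (γ' : AtomicMeasure κ E) :
    ∫ x, (γ.density x - γ'.density x) ^ 2 ∂(stdGaussian E) = γ.sqDist γ' := by
  simp only [← density_diff, integral_sq_density, sqDist]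

theorem sqDist_comm (γ : AtomicMeasure ι E) (γ' : AtomicMeasure κ E) :
    γ.sqDist γ' = γ'.sqDist γ := by
  rw [← integral_sq_density_sub, ← integral_sq_density_sub]
  simp only [sub_sq_comm]

theorem sqDist_self (γ : AtomicMeasure ι E) : γ.sqDist γ = 0 := by
  simp [← integral_sq_density_sub]

theorem IsMixing.sqDist_le_sqHellinger (h : γ.IsMixing R) (h' : γ'.IsMixing R) (hR : 0 ≤ R) :
    γ.sqDist γ' ≤ 4 * tiltConst R (Fintype.card (ι ⊕ κ))
      * sqHellinger (stdGaussian E) γ.density γ'.density := by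
  have hγ := norm_atom_diff_le h.norm_atom_le h'.norm_atom_le
  have left := (γ.diff γ').integrable_sq_density_mul_density γ
  have right := (γ.diff γ').integrable_sq_density_mul_density γ'
  have left_le := integral_sq_density_mul_density_le hR hγ h
  have right_le := integral_sq_density_mul_density_le hR hγ h'
  have sq := (γ.diff γ').integrable_sq_density
  simp only [density_diff] at left right left_le right_le sq
  rw [← integral_sq_density_sub]
  refine h.isPosDensity.integral_sq_sub_le_mul_sqHellinger h'.isPosDensity (tiltConst_pos _ _) sq
    ?_ ?_ <;> simp only [mul_add]
  · exact left.add right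
  · rw [integral_add left right, integral_sq_density_sub, sqDist]
    linarith

theorem IsMixing.integrable_sq_density_sub_div (h : γ.IsMixing R) (h' : γ'.IsMixing R) :
    Integrable (fun x => (γ.density x - γ'.density x) ^ 2 / γ'.density x) (stdGaussian E) := by
  refine (((γ.diff γ').integrable_sq_density_mul_density γ'.reflect).const_mul
    (Real.exp (R ^ 2))).mono' (((h.isPosDensity.measurable.sub
      h'.isPosDensity.measurable).pow_const 2).div h'.isPosDensity.measurable).aestronglyMeasurable
    (ae_of_all _ fun x => ?_)
  rw [Real.norm_of_nonneg (div_nonneg (sq_nonneg _) (h'.isPosDensity.nonneg x)), ← density_diff]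
  exact h'.sq_density_div_density_le x

/-- A bound for the ratio of the `χ²`-divergence and the squared `L²` distance of two mixtures with
`N` atoms altogether. -/
def chiConst (R : ℝ) (N : ℕ) : ℝ := Real.exp (R ^ 2) * tiltConst R N

theorem IsMixing.chiSq_le (h : γ.IsMixing R) (h' : γ'.IsMixing R) (hR : 0 ≤ R) :
    chiSq (stdGaussian E) γ.density γ'.density
      ≤ chiConst R (Fintype.card (ι ⊕ κ)) * γ.sqDist γ' := by
  have hγ := norm_atom_diff_le h.norm_atom_le h'.norm_atom_le
  have integrable := ((γ.diff γ').integrable_sq_density_mul_density γ'.reflect).const_mul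
    (Real.exp (R ^ 2))
  have pointwise (x : E) : (γ.density x - γ'.density x) ^ 2 / γ'.density x
      ≤ Real.exp (R ^ 2) * ((γ.diff γ').density x ^ 2 * γ'.reflect.density x) := by
    simpa only [density_diff] using h'.sq_density_div_density_le (γ := γ.diff γ') x
  refine (integral_mono (h.integrable_sq_density_sub_div h') integrable pointwise).trans ?_
  rw [MeasureTheory.integral_const_mul, chiConst, mul_assoc]
  exact mul_le_mul_of_nonneg_left
    (integral_sq_density_mul_density_le hR hγ h'.reflect) (Real.exp_pos _).le

/-- The Gaussian mixture with a given atomic mixing measure. -/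
def law (γ : AtomicMeasure ι E) : Measure E := densityMeasure (stdGaussian E) γ.density

end AtomicMeasure

section FiniteSets

theorem exists_measurable_argmax {Ω β : Type*} [MeasurableSpace Ω] {S : Finset β}
    (hS : S.Nonempty) {f : β → Ω → ℝ} (hf : ∀ b ∈ S, Measurable (f b)) :
    ∃ sel : Ω → β, Measurable[_, ⊤] sel ∧ (∀ x, sel x ∈ S) ∧
      ∀ x, ∀ b ∈ S, f b x ≤ f (sel x) x := by
  classical
  let : MeasurableSpace β := ⊤
  induction hS using Finset.Nonempty.cons_induction with
  | singleton a => exact ⟨fun _ => a, measurable_const, by simp, by simp⟩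
  | cons a S ha _ ih =>
    simp only [Finset.mem_cons, forall_eq_or_imp] at hf ⊢
    obtain ⟨sel, sel_measurable, sel_mem, le_sel⟩ := ih hf.2
    have wins_measurable : MeasurableSet {x | ∀ b ∈ S, f b x ≤ f a x} := by
      simp only [Set.ofPred_forall]
      exact Finset.measurableSet_biInter _ fun b hb => measurableSet_le (hf.2 b hb) hf.1
    refine ⟨fun x => if ∀ b ∈ S, f b x ≤ f a x then a else sel x,
      Measurable.ite wins_measurable measurable_const sel_measurable, fun x => ?_, fun x => ?_⟩ <;>
      beta_reduce
    · split_ifs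
      · exact Or.inl rfl
      · exact Or.inr (sel_mem x)
    · split_ifs with wins
      · exact ⟨le_rfl, wins⟩
      · push Not at wins
        obtain ⟨b, hb, hlt⟩ := wins
        exact ⟨hlt.le.trans (le_sel x b hb), le_sel x⟩

theorem exists_maximal_pairwise {α : Type*} {s : Set α} {r : α → α → Prop} (hr : Std.Symm r)
    {M : ℕ} (hM : ∀ S : Finset α, (S : Set α) ⊆ s → (S : Set α).Pairwise r → S.card ≤ M) :
    ∃ S : Finset α, (S : Set α) ⊆ s ∧ (S : Set α).Pairwise r ∧
      ∀ a ∈ s, a ∉ S → ∃ b ∈ S, ¬ r a b := by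
  classical
  let cards : Set ℕ := {m | ∃ S : Finset α, (S : Set α) ⊆ s ∧ (S : Set α).Pairwise r ∧ S.card = m}
  have cards_nonempty : cards.Nonempty := ⟨0, ∅, by simp⟩
  have cards_bdd : BddAbove cards := ⟨M, by rintro m ⟨S, hS, hSr, rfl⟩; exact hM S hS hSr⟩
  obtain ⟨S, hS, hSr, hcard⟩ := Nat.sSup_mem cards_nonempty cards_bdd
  refine ⟨S, hS, hSr, fun a ha haS => ?_⟩
  by_contra! hfar
  have insert_pairwise : ((insert a S : Finset α) : Set α).Pairwise r := by
    rw [Finset.coe_insert]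
    exact hSr.insert fun b hb _ => ⟨hfar b hb, hr.symm _ _ (hfar b hb)⟩
  have insert_subset : ((insert a S : Finset α) : Set α) ⊆ s := by
    rw [Finset.coe_insert]
    exact Set.insert_subset ha hS
  have := le_csSup cards_bdd ⟨insert a S, insert_subset, insert_pairwise, rfl⟩
  rw [Finset.card_insert_of_notMem haS] at this
  lia

variable {β : Type*} {S : Finset β} {ρ : β → ℝ} {J : ℝ} {D : ℕ}

theorem sum_inv_pow_le_of_card_le (hρ : ∀ b ∈ S, 0 ≤ ρ b)
    (hcard : ∀ r : ℝ, 1 ≤ r → ∀ T ⊆ S, (∀ b ∈ T, ρ b ≤ r) → (T.card : ℝ) ≤ (J * r) ^ D)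
    (hJ : 0 ≤ J) : ∑ b ∈ S, ((1 + ρ b) ^ (D + 2))⁻¹ ≤ 2 * J ^ D := by
  classical
  let shell (b : β) : ℕ := ⌊ρ b⌋₊ + 1
  have shell_mem (b) (hb : b ∈ S) : shell b ∈ Finset.Ioo 0 (S.sup shell + 1) :=
    Finset.mem_Ioo.2 ⟨Nat.succ_pos _, Nat.lt_succ_of_le (Finset.le_sup hb)⟩
  have shell_sum_le (i : ℕ) (hi : i ∈ Finset.Ioo 0 (S.sup shell + 1)) :
      ∑ b ∈ S with shell b = i, ((1 + ρ b) ^ (D + 2))⁻¹ ≤ J ^ D * ((i : ℝ) ^ 2)⁻¹ := by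
    have hi : (1 : ℝ) ≤ i := by exact_mod_cast (Finset.mem_Ioo.1 hi).1
    have term_le (b) (hb : b ∈ S.filter (shell · = i)) :
        ((1 + ρ b) ^ (D + 2))⁻¹ ≤ ((i : ℝ) ^ (D + 2))⁻¹ := by
      obtain ⟨hbS, rfl⟩ := Finset.mem_filter.1 hb
      have := Nat.floor_le (hρ b hbS)
      gcongr
      push_cast [shell]
      linarith
    have card_le := hcard i hi (S.filter (shell · = i)) (Finset.filter_subset _ _) fun b hb => by
      rw [← (Finset.mem_filter.1 hb).2]
      exact_mod_cast (Nat.lt_floor_add_one _).le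
    calc _ ≤ ((S.filter (shell · = i)).card : ℝ) * ((i : ℝ) ^ (D + 2))⁻¹ := by
          rw [← nsmul_eq_mul]
          exact Finset.sum_le_card_nsmul _ _ _ term_le
      _ ≤ (J * i) ^ D * ((i : ℝ) ^ (D + 2))⁻¹ := by gcongr
      _ = J ^ D * ((i : ℝ) ^ 2)⁻¹ := by
          rw [mul_pow, pow_add]
          field_simp
  calc _ = ∑ i ∈ Finset.Ioo 0 (S.sup shell + 1),
        ∑ b ∈ S with shell b = i, ((1 + ρ b) ^ (D + 2))⁻¹ :=
        (Finset.sum_fiberwise_of_maps_to shell_mem _).symm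
    _ ≤ J ^ D * ∑ i ∈ Finset.Ioo 0 (S.sup shell + 1), ((i : ℝ) ^ 2)⁻¹ := by
        rw [Finset.mul_sum]
        exact Finset.sum_le_sum shell_sum_le
    _ ≤ J ^ D * 2 := by
        gcongr
        simpa using sum_Ioo_inv_sq_le (α := ℝ) 0 (S.sup shell + 1)
    _ = 2 * J ^ D := mul_comm _ _

theorem one_add_le_exp {b : ℝ} (hb : 0 ≤ b) (y : ℝ) :
    1 + y ≤ Real.exp (b + 1 + Real.exp (-2 * b) * y ^ 2) := by
  let z := (1 + y) * Real.exp (-b)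
  have le_exp_sq : z ≤ Real.exp (z ^ 2 / 2) := by
    nlinarith [Real.add_one_le_exp (z ^ 2 / 2), sq_nonneg (z - 1)]
  have sq_le : z ^ 2 / 2 ≤ 1 + Real.exp (-2 * b) * y ^ 2 := by
    have exp_sq : Real.exp (-b) ^ 2 = Real.exp (-2 * b) := by
      rw [← Real.exp_nat_mul]
      ring_nf
    have exp_le_one : Real.exp (-2 * b) ≤ 1 := Real.exp_le_one_iff.2 (by linarith)
    rw [mul_pow, exp_sq]
    nlinarith [mul_nonneg (Real.exp_pos (-2 * b)).le (sq_nonneg (1 - y))]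
  calc 1 + y = Real.exp b * z := by
        rw [mul_left_comm, ← Real.exp_add, add_neg_cancel, Real.exp_zero, mul_one]
    _ ≤ Real.exp b * Real.exp (1 + Real.exp (-2 * b) * y ^ 2) := by
        gcongr
        exact le_exp_sq.trans (Real.exp_le_exp.2 sq_le)
    _ = _ := by rw [← Real.exp_add, add_assoc]

theorem sum_exp_neg_sq_le_of_card_le (hρ : ∀ b ∈ S, 0 ≤ ρ b)
    (hcard : ∀ r : ℝ, 1 ≤ r → ∀ T ⊆ S, (∀ b ∈ T, ρ b ≤ r) → (T.card : ℝ) ≤ (J * r) ^ D)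
    (hJ : 0 ≤ J) {b c : ℝ} (hb : 0 ≤ b) (hc : (D + 2) * Real.exp (-2 * b) ≤ c) :
    ∑ a ∈ S, Real.exp (-(c * ρ a ^ 2)) ≤ 2 * J ^ D * Real.exp ((b + 1) * (D + 2)) := by
  have term_le (a) (ha : a ∈ S) : Real.exp (-(c * ρ a ^ 2))
      ≤ ((1 + ρ a) ^ (D + 2))⁻¹ * Real.exp ((b + 1) * (D + 2)) := by
    have base_pos : 0 < 1 + ρ a := by linarith [hρ a ha]
    rw [inv_mul_eq_div, le_div_iff₀ (pow_pos base_pos _), mul_comm]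
    calc (1 + ρ a) ^ (D + 2) * Real.exp (-(c * ρ a ^ 2))
        ≤ Real.exp (b + 1 + Real.exp (-2 * b) * ρ a ^ 2) ^ (D + 2)
          * Real.exp (-(c * ρ a ^ 2)) := by
          gcongr
          exact one_add_le_exp hb _
      _ ≤ Real.exp ((b + 1) * (D + 2)) := by
          rw [← Real.exp_nat_mul, ← Real.exp_add, Real.exp_le_exp]
          push_cast
          nlinarith [mul_le_mul_of_nonneg_right hc (sq_nonneg (ρ a))]
  refine (Finset.sum_le_sum term_le).trans ?_
  rw [← Finset.sum_mul]
  gcongr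
  exact sum_inv_pow_le_of_card_le hρ hcard hJ

end FiniteSets

namespace AtomicMeasure

section MaximumLikelihood

variable {ι E : Type*} [Fintype ι] [NormedAddCommGroup E] [InnerProductSpace ℝ E]
  [FiniteDimensional ℝ E] {R ε : ℝ} {γ γ₀ γ₁ : AtomicMeasure ι E}
  {S : Finset (AtomicMeasure ι E)} {N : ℕ}

/-- A finite set of mixing measures that are `ε`-separated in the `L²` distance of their
densities: the candidates of the maximum likelihood estimator. -/
structure IsSeparatedMixing (R ε : ℝ) (S : Finset (AtomicMeasure ι E)) : Prop where
  isMixing : ∀ γ ∈ S, γ.IsMixing R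
  pairwise : (S : Set (AtomicMeasure ι E)).Pairwise fun γ γ' => ε ^ 2 ≤ γ.sqDist γ'

theorem IsSeparatedMixing.sum_exp_neg_sqDist_le (h : IsSeparatedMixing R ε S) (hR : 0 ≤ R)
    (hε : 0 < ε) (γ₀ : AtomicMeasure ι E) (hN : N = Fintype.card (ι ⊕ ι)) {m : ℕ}
    (hm : m = N * Module.finrank ℝ E + N ^ N) {b c : ℝ} (hb : 0 ≤ b)
    (hc : (m + 2) * Real.exp (-2 * b) ≤ c * ε ^ 2) :
    ∑ γ ∈ S, Real.exp (-(c * γ.sqDist γ₀))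
      ≤ 2 * (6 * decodingConst R N) ^ m * Real.exp ((b + 1) * (m + 2)) := by
  let ρ (γ : AtomicMeasure ι E) : ℝ := √(γ.sqDist γ₀) / ε
  have ρ_sq (γ) : ε ^ 2 * ρ γ ^ 2 = γ.sqDist γ₀ := by
    rw [div_pow, Real.sq_sqrt (sqDist_nonneg _ _), mul_div_cancel₀ _ (by positivity)]
  have card_le (r : ℝ) (hr : 1 ≤ r) (T) (hT : T ⊆ S) (hTr : ∀ γ ∈ T, ρ γ ≤ r) :
      (T.card : ℝ) ≤ (6 * decodingConst R N * r) ^ m := by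
    have := card_packing_le (γ₀ := γ₀) (r := ε * r) hR T
      (fun γ hγ => (h.isMixing γ (hT hγ)).norm_atom_le) hε (le_mul_of_one_le_right hε.le hr)
      (fun γ hγ => by
        rw [← ρ_sq, ← mul_pow]
        exact pow_le_pow_left₀ (by positivity) (mul_le_mul_of_nonneg_left (hTr γ hγ) hε.le) 2)
      (h.pairwise.mono (Finset.coe_subset.2 hT)) hN
    rwa [mul_div_cancel_left₀ _ hε.ne', ← hm] at this
  have := one_le_decodingConst R N
  simpa only [mul_assoc, ρ_sq] using
    sum_exp_neg_sq_le_of_card_le (ρ := ρ) (fun γ _ => by positivity) card_le (by positivity) hb hc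

variable [MeasurableSpace E] [BorelSpace E]

theorem IsMixing.sqDist_le (h : γ.IsMixing R) (h₀ : γ₀.IsMixing R) (hR : 0 ≤ R) :
    γ.sqDist γ₀ ≤ 8 * tiltConst R (Fintype.card (ι ⊕ ι)) := by
  have := tiltConst_pos R (Fintype.card (ι ⊕ ι))
  calc γ.sqDist γ₀ ≤ _ := h.sqDist_le_sqHellinger h₀ hR
    _ ≤ 4 * tiltConst R (Fintype.card (ι ⊕ ι)) * 2 := by
        gcongr
        exact h.isPosDensity.sqHellinger_le_two h₀.isPosDensity
    _ = _ := by ring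

theorem exists_net [Nonempty ι] (hR : 0 ≤ R) (hε : 0 < ε) :
    ∃ S : Finset (AtomicMeasure ι E), S.Nonempty ∧ IsSeparatedMixing R ε S ∧
      ∀ γ : AtomicMeasure ι E, γ.IsMixing R → ∃ γ₀ ∈ S, γ.sqDist γ₀ ≤ ε ^ 2 := by
  obtain ⟨γ₁, h₁⟩ := exists_isMixing (ι := ι) (E := E) hR
  let r := max ε √(8 * tiltConst R (Fintype.card (ι ⊕ ι)))
  have sqDist_le (γ : AtomicMeasure ι E) (h : γ.IsMixing R) : γ.sqDist γ₁ ≤ r ^ 2 :=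
    (h.sqDist_le h₁ hR).trans
      ((Real.sqrt_le_left (hε.le.trans (le_max_left _ _))).1 (le_max_right _ _))
  obtain ⟨S, hS, hSε, hmax⟩ := exists_maximal_pairwise
    (s := {γ : AtomicMeasure ι E | γ.IsMixing R}) (r := fun γ γ' => ε ^ 2 ≤ γ.sqDist γ')
    ⟨fun γ γ' h => h.trans_eq (sqDist_comm γ γ')⟩ fun S hS hSε =>
      Nat.cast_le.1 ((card_packing_le hR S (fun γ hγ => (hS hγ).norm_atom_le) hε (le_max_left _ _)
        (fun γ hγ => sqDist_le γ (hS hγ)) hSε rfl).trans (Nat.le_ceil _))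
  have covering (γ : AtomicMeasure ι E) (h : γ.IsMixing R) : ∃ γ₀ ∈ S, γ.sqDist γ₀ ≤ ε ^ 2 := by
    by_cases hγ : γ ∈ S
    · exact ⟨γ, hγ, by rw [sqDist_self]; positivity⟩
    · exact (hmax γ h hγ).imp fun γ₀ hγ₀ => ⟨hγ₀.1, (not_le.1 hγ₀.2).le⟩
  exact ⟨S, (covering γ₁ h₁).imp fun _ h => h.1, ⟨hS, hSε⟩, covering⟩

theorem IsMixing.pi_density_le (h : γ.IsMixing R) (h₀ : γ₀.IsMixing R) (h₁ : γ₁.IsMixing R)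
    (hR : 0 ≤ R) (hN : N = Fintype.card (ι ⊕ ι)) (hγ : γ.sqDist γ₀ ≤ ε ^ 2) {t : ℝ}
    (ht : t ≤ sqHellinger (stdGaussian E) γ₁.density γ₀.density) (n : ℕ) :
    Measure.pi (fun _ : Fin n => γ.law) {x | ∏ i, γ₀.density (x i) ≤ ∏ i, γ₁.density (x i)}
      ≤ ENNReal.ofReal (Real.exp (n * (chiConst R N * ε ^ 2 - t / 8))
        * Real.exp (-(n / (32 * tiltConst R N) * γ₁.sqDist γ₀))) := by
  have tilt_pos := tiltConst_pos R N
  have chi_le : chiSq (stdGaussian E) γ.density γ₀.density ≤ chiConst R N * ε ^ 2 :=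
    (hN ▸ h.chiSq_le h₀ hR).trans (mul_le_mul_of_nonneg_left hγ (by unfold chiConst; positivity))
  have sqDist_le : γ₁.sqDist γ₀ / (32 * tiltConst R N)
      ≤ sqHellinger (stdGaussian E) γ₁.density γ₀.density / 8 := by
    rw [div_le_iff₀ (by positivity)]
    linarith [hN ▸ h₁.sqDist_le_sqHellinger h₀ hR]
  refine (h.isPosDensity.pi_likelihood_le h₀.isPosDensity h₁.isPosDensity
    (h.integrable_sq_density_sub_div h₀) n).trans (ENNReal.ofReal_le_ofReal ?_)
  rw [← Real.exp_add, Real.exp_le_exp, div_mul_eq_mul_div, mul_div_assoc, ← mul_neg, ← mul_add]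
  gcongr
  linarith

theorem IsSeparatedMixing.pi_sqHellinger_gt_le (hS : IsSeparatedMixing R ε S) (hR : 0 ≤ R)
    (hε : 0 < ε) {n : ℕ} {sel : (Fin n → E) → AtomicMeasure ι E} (sel_mem : ∀ x, sel x ∈ S)
    (le_sel : ∀ x, ∀ γ ∈ S, ∏ i, γ.density (x i) ≤ ∏ i, (sel x).density (x i))
    (h : γ.IsMixing R) (h₀ : γ₀ ∈ S) (hγ : γ.sqDist γ₀ ≤ ε ^ 2) (hN : N = Fintype.card (ι ⊕ ι))
    {m : ℕ} (hm : m = N * Module.finrank ℝ E + N ^ N) {b : ℝ} (hb : 0 ≤ b)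
    (hc : (m + 2) * Real.exp (-2 * b) ≤ n / (32 * tiltConst R N) * ε ^ 2) (t : ℝ) :
    Measure.pi (fun _ : Fin n => γ.law)
        {x | t < sqHellinger (stdGaussian E) (sel x).density γ₀.density}
      ≤ ENNReal.ofReal (Real.exp (n * (chiConst R N * ε ^ 2 - t / 8))
        * (2 * (6 * decodingConst R N) ^ m * Real.exp ((b + 1) * (m + 2)))) := by
  classical
  set T := S.filter fun γ₁ => t < sqHellinger (stdGaussian E) γ₁.density γ₀.density
  have cover : {x | t < sqHellinger (stdGaussian E) (sel x).density γ₀.density} ⊆ ⋃ γ₁ ∈ T,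
      {x : Fin n → E | ∏ i, γ₀.density (x i) ≤ ∏ i, γ₁.density (x i)} := fun x hx =>
    Set.mem_biUnion (Finset.mem_coe.2 (Finset.mem_filter.2 ⟨sel_mem x, hx⟩)) (le_sel x γ₀ h₀)
  calc _ ≤ ∑ γ₁ ∈ T, Measure.pi (fun _ : Fin n => γ.law)
        {x : Fin n → E | ∏ i, γ₀.density (x i) ≤ ∏ i, γ₁.density (x i)} :=
        (measure_mono cover).trans (measure_biUnion_finset_le _ _)
    _ ≤ ∑ γ₁ ∈ T, ENNReal.ofReal (Real.exp (n * (chiConst R N * ε ^ 2 - t / 8))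
          * Real.exp (-(n / (32 * tiltConst R N) * γ₁.sqDist γ₀))) :=
        Finset.sum_le_sum fun γ₁ h₁ => h.pi_density_le (hS.isMixing γ₀ h₀)
          (hS.isMixing γ₁ (Finset.mem_filter.1 h₁).1) hR hN hγ (Finset.mem_filter.1 h₁).2.le n
    _ = ENNReal.ofReal (Real.exp (n * (chiConst R N * ε ^ 2 - t / 8))
          * ∑ γ₁ ∈ T, Real.exp (-(n / (32 * tiltConst R N) * γ₁.sqDist γ₀))) := by
        rw [Finset.mul_sum, ENNReal.ofReal_sum_of_nonneg fun _ _ => by positivity]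
    _ ≤ _ := by
        refine ENNReal.ofReal_le_ofReal (mul_le_mul_of_nonneg_left ?_ (Real.exp_pos _).le)
        exact (Finset.sum_le_sum_of_subset_of_nonneg (Finset.filter_subset _ _)
          fun _ _ _ => (Real.exp_pos _).le).trans
          (hS.sum_exp_neg_sqDist_le hR hε γ₀ hN hm hb hc)

end MaximumLikelihood

end AtomicMeasure

section Constants

variable {R : ℝ} {k d m : ℕ}

/-- The rate at which the logarithms of the constants `tiltConst`, `chiConst` and `decodingConst`
of two measures with `k` atoms each grow in `k ^ 2`. -/
def logRate (R : ℝ) : ℝ := 10 + 2 * (1 + 2 * R) ^ 2 + 2 * (R * (1 + 2 * R)) + R ^ 2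

theorem logRate_pos (hR : 0 ≤ R) : 0 < logRate R := by
  unfold logRate
  positivity

theorem self_pow_le_exp (k : ℕ) : ((2 * k : ℕ) : ℝ) ^ (2 * k) ≤ Real.exp (4 * (k : ℝ) ^ 2) :=
  calc ((2 * k : ℕ) : ℝ) ^ (2 * k) ≤ Real.exp ((2 * k : ℕ) : ℝ) ^ (2 * k) := by
        gcongr
        linarith [Real.add_one_le_exp ((2 * k : ℕ) : ℝ)]
    _ = Real.exp (4 * (k : ℝ) ^ 2) := by
        rw [← Real.exp_nat_mul]
        push_cast
        ring_nf

theorem factorial_le_exp (k : ℕ) : ((2 * k).factorial : ℝ) ≤ Real.exp (4 * (k : ℝ) ^ 2) :=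
  (by exact_mod_cast Nat.factorial_le_pow (2 * k)
    : ((2 * k).factorial : ℝ) ≤ ((2 * k : ℕ) : ℝ) ^ (2 * k)).trans (self_pow_le_exp k)

theorem chiConst_le_exp (hR : 0 ≤ R) (hk : 1 ≤ k) :
    AtomicMeasure.chiConst R (2 * k) ≤ Real.exp (logRate R * (k : ℝ) ^ 2) := by
  have hk : (1 : ℝ) ≤ k := by exact_mod_cast hk
  calc AtomicMeasure.chiConst R (2 * k)
      ≤ Real.exp (R ^ 2) * (Real.exp ((2 * k : ℕ) * (1 + 2 * R) ^ 2 + 2 * (R * (1 + 2 * R)))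
          * Real.exp (4 * (k : ℝ) ^ 2)) := by
        unfold AtomicMeasure.chiConst AtomicMeasure.tiltConst
        gcongr
        exact factorial_le_exp k
    _ = Real.exp (R ^ 2 * 1 + 2 * (1 + 2 * R) ^ 2 * k + 2 * (R * (1 + 2 * R)) * 1 + 4 * k ^ 2) := by
        rw [← Real.exp_add, ← Real.exp_add]
        push_cast
        ring_nf
    _ ≤ Real.exp (R ^ 2 * k ^ 2 + 2 * (1 + 2 * R) ^ 2 * k ^ 2 + 2 * (R * (1 + 2 * R)) * k ^ 2
          + 10 * k ^ 2) := by
        gcongr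
        · nlinarith
        · nlinarith
        · nlinarith
        · norm_num
    _ = _ := by
        unfold logRate
        ring_nf

theorem tiltConst_le_exp (hR : 0 ≤ R) (hk : 1 ≤ k) :
    AtomicMeasure.tiltConst R (2 * k) ≤ Real.exp (logRate R * (k : ℝ) ^ 2) :=
  (le_mul_of_one_le_left (AtomicMeasure.tiltConst_pos R (2 * k)).le
    (Real.one_le_exp (sq_nonneg R))).trans (chiConst_le_exp hR hk)

theorem six_mul_decodingConst_le_exp (hR : 0 ≤ R) (hk : 1 ≤ k) :
    6 * AtomicMeasure.decodingConst R (2 * k) ≤ Real.exp (logRate R * (k : ℝ) ^ 2) := by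
  have hk : (1 : ℝ) ≤ k := by exact_mod_cast hk
  have six_le : (6 : ℝ) ≤ Real.exp 2 := by
    have := Real.exp_one_pow 2
    push_cast at this
    nlinarith [Real.exp_one_gt_d9]
  have sqrt_factorial_le : √((2 * k).factorial : ℝ) ≤ Real.exp (4 * (k : ℝ) ^ 2) :=
    (Real.sqrt_le_sqrt (factorial_le_exp k)).trans (by
      rw [← Real.exp_half]
      gcongr
      linarith [sq_nonneg (k : ℝ)])
  calc 6 * AtomicMeasure.decodingConst R (2 * k)
      ≤ Real.exp 2 * (Real.exp (4 * (k : ℝ) ^ 2) * Real.exp (4 * (k : ℝ) ^ 2)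
          * Real.exp ((2 * k : ℕ) * (1 + 2 * R) ^ 2 / 2)) := by
        unfold AtomicMeasure.decodingConst
        gcongr
        exact self_pow_le_exp k
    _ = Real.exp (2 * 1 + 8 * k ^ 2 + (1 + 2 * R) ^ 2 * k) := by
        rw [← Real.exp_add, ← Real.exp_add, ← Real.exp_add]
        push_cast
        ring_nf
    _ ≤ Real.exp (2 * k ^ 2 + 8 * k ^ 2 + (2 * (1 + 2 * R) ^ 2 + 2 * (R * (1 + 2 * R)) + R ^ 2)
          * k ^ 2) := by
        gcongr
        · nlinarith
        · nlinarith [mul_nonneg hR (by positivity : 0 ≤ 1 + 2 * R), sq_nonneg R]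
        · nlinarith
    _ = _ := by
        unfold logRate
        ring_nf

/-- The effective dimension of the `k`-component Gaussian mixtures on `ℝ^d`. -/
def effDim (k d : ℕ) : ℝ := (k : ℝ) ^ 4 * d + (2 * k : ℝ) ^ (2 * k + 2)

theorem one_le_effDim (hk : 1 ≤ k) (d : ℕ) : 1 ≤ effDim k d := by
  have hk : (1 : ℝ) ≤ k := by exact_mod_cast hk
  exact le_add_of_nonneg_of_le (by positivity) (one_le_pow₀ (by linarith))

theorem packingDim_mul_sq_le (hk : 1 ≤ k) (hm : m = 2 * k * d + (2 * k) ^ (2 * k)) :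
    (m + 2) * (k : ℝ) ^ 2 ≤ 3 * effDim k d := by
  have hk : (1 : ℝ) ≤ k := by exact_mod_cast hk
  have hkd : (k : ℝ) ^ 3 * d ≤ (k : ℝ) ^ 4 * d := by
    gcongr
    norm_num
  have hpow : (1 : ℝ) ≤ (2 * k : ℝ) ^ (2 * k) := one_le_pow₀ (by linarith)
  rw [hm, effDim, pow_add (2 * k : ℝ)]
  push_cast
  nlinarith [mul_le_mul_of_nonneg_right hpow (sq_nonneg (k : ℝ)),
    (by positivity : (0 : ℝ) ≤ (k : ℝ) ^ 4 * d)]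

theorem packingDim_le (hk : 1 ≤ k) (hm : m = 2 * k * d + (2 * k) ^ (2 * k)) :
    m + 2 ≤ 3 * effDim k d :=
  (le_mul_of_one_le_right (by positivity) (one_le_pow₀ (by exact_mod_cast hk))).trans
    (packingDim_mul_sq_le hk hm)

theorem packing_sum_le_exp (hR : 0 ≤ R) (hk : 1 ≤ k)
    (hm : m = 2 * k * d + (2 * k) ^ (2 * k)) :
    2 * (6 * AtomicMeasure.decodingConst R (2 * k)) ^ m
        * Real.exp ((logRate R * (k : ℝ) ^ 2 + 3 + 1) * (m + 2))
      ≤ Real.exp (effDim k d * (6 * logRate R + 13)) := by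
  have rate_pos := logRate_pos hR
  have := AtomicMeasure.one_le_decodingConst R (2 * k)
  calc _ ≤ Real.exp 1 * Real.exp (logRate R * (k : ℝ) ^ 2) ^ m
        * Real.exp ((logRate R * (k : ℝ) ^ 2 + 3 + 1) * (m + 2)) := by
        gcongr
        · linarith [Real.exp_one_gt_d9]
        · exact six_mul_decodingConst_le_exp hR hk
    _ ≤ _ := by
        rw [← Real.exp_nat_mul, ← Real.exp_add, ← Real.exp_add, Real.exp_le_exp]
        nlinarith [mul_le_mul_of_nonneg_left (packingDim_mul_sq_le hk hm) rate_pos.le,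
          packingDim_le hk hm, one_le_effDim hk d, mul_nonneg rate_pos.le (sq_nonneg (k : ℝ))]

theorem packingDim_mul_exp_neg_le (hR : 0 ≤ R) (hk : 1 ≤ k)
    (hm : m = 2 * k * d + (2 * k) ^ (2 * k)) :
    (m + 2) * Real.exp (-2 * (logRate R * (k : ℝ) ^ 2 + 3))
      ≤ effDim k d / (32 * AtomicMeasure.tiltConst R (2 * k)
        * AtomicMeasure.chiConst R (2 * k)) := by
  have tilt_pos := AtomicMeasure.tiltConst_pos R (2 * k)
  have chi_pos : 0 < AtomicMeasure.chiConst R (2 * k) := mul_pos (Real.exp_pos _) tilt_pos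
  have le_exp_six : (96 : ℝ) ≤ Real.exp 6 := by
    calc (96 : ℝ) ≤ 2.7 ^ 6 := by norm_num
      _ ≤ Real.exp 1 ^ 6 := by
          gcongr
          linarith [Real.exp_one_gt_d9]
      _ = Real.exp 6 := mod_cast Real.exp_one_pow 6
  rw [le_div_iff₀ (by positivity)]
  calc _ ≤ 3 * effDim k d * Real.exp (-2 * (logRate R * (k : ℝ) ^ 2 + 3))
        * (Real.exp 6 / 3 * Real.exp (logRate R * (k : ℝ) ^ 2)
          * Real.exp (logRate R * (k : ℝ) ^ 2)) := by
        have := packingDim_le hk hm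
        have : 0 < effDim k d := zero_lt_one.trans_le (one_le_effDim hk d)
        gcongr
        · linarith
        · exact tiltConst_le_exp hR hk
        · exact chiConst_le_exp hR hk
    _ = effDim k d * Real.exp (-2 * (logRate R * (k : ℝ) ^ 2 + 3) + 6 + logRate R * (k : ℝ) ^ 2
          + logRate R * (k : ℝ) ^ 2) := by
        rw [Real.exp_add, Real.exp_add, Real.exp_add]
        ring
    _ = effDim k d := by
        ring_nf
        simp

/-- The constant in the high-probability bound for the squared Hellinger loss. -/
def tailConst (R : ℝ) : ℝ := 192 * logRate R + 468

theorem tailConst_pos (hR : 0 ≤ R) : 0 < tailConst R := by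
  have := logRate_pos hR
  unfold tailConst
  positivity

theorem half_le_log_one_div {δ : ℝ} (hδ : 0 < δ) (hδ_half : δ < 1 / 2) :
    1 / 2 ≤ Real.log (1 / δ) := by
  have := Real.log_le_log two_pos ((le_div_comm₀ two_pos hδ).2 hδ_half.le)
  linarith [Real.log_two_gt_d9]

theorem le_tailConst_mul (hR : 0 ≤ R) {D L : ℝ} (hD : 1 ≤ D) (hL : 1 / 2 ≤ L) :
    2 * (8 * (D * (6 * logRate R + 14) + L)) + 2 * D ≤ tailConst R * (D * L) := by
  have rate_pos := logRate_pos hR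
  have D_le : D ≤ 2 * (D * L) := by nlinarith
  have L_le : L ≤ D * L := le_mul_of_one_le_left (by linarith) hD
  unfold tailConst
  nlinarith [mul_le_mul_of_nonneg_right D_le rate_pos.le]

end Constants

namespace AtomicMeasure

section Estimator

variable {E : Type*} [NormedAddCommGroup E] [InnerProductSpace ℝ E] [FiniteDimensional ℝ E]
  [MeasurableSpace E] [BorelSpace E] {R : ℝ} {k n : ℕ}

theorem sqHellinger_le_of_net {ε D L : ℝ} {γ γ₀ γ₁ : AtomicMeasure (Fin k) E} (hR : 0 ≤ R)
    (h : γ.IsMixing R) (h₀ : γ₀.IsMixing R) (h₁ : γ₁.IsMixing R) (hγ : γ.sqDist γ₀ ≤ ε ^ 2)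
    (hn : 0 < n) (hD : 1 ≤ D) (hL : 1 / 2 ≤ L) (hε : n * (chiConst R (2 * k) * ε ^ 2) = D)
    (hsel : sqHellinger (stdGaussian E) γ₁.density γ₀.density
      ≤ 8 / n * (D * (6 * logRate R + 14) + L)) :
    sqHellinger (stdGaussian E) γ₁.density γ.density ≤ tailConst R * (D / n * L) := by
  have card_eq : 2 * k = Fintype.card (Fin k ⊕ Fin k) := by simp [two_mul]
  have chi_nonneg : 0 ≤ chiConst R (2 * k) :=
    (mul_pos (Real.exp_pos _) (tiltConst_pos R (2 * k))).le
  have approximation : sqHellinger (stdGaussian E) γ₀.density γ.density ≤ D / n := by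
    rw [sqHellinger_comm, le_div_iff₀' (by exact_mod_cast hn), ← hε]
    gcongr
    calc _ ≤ chiSq (stdGaussian E) γ.density γ₀.density :=
          h.isPosDensity.sqHellinger_le_chiSq h₀.isPosDensity (h.integrable_sq_density_sub_div h₀)
      _ ≤ chiConst R (2 * k) * γ.sqDist γ₀ := card_eq ▸ h.chiSq_le h₀ hR
      _ ≤ chiConst R (2 * k) * ε ^ 2 := by gcongr
  calc _ ≤ 2 * sqHellinger (stdGaussian E) γ₁.density γ₀.density
        + 2 * sqHellinger (stdGaussian E) γ₀.density γ.density :=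
        h₁.isPosDensity.sqHellinger_triangle h₀.isPosDensity h.isPosDensity
    _ ≤ 2 * (8 / n * (D * (6 * logRate R + 14) + L)) + 2 * (D / n) := by gcongr
    _ = (2 * (8 * (D * (6 * logRate R + 14) + L)) + 2 * D) / n := by ring
    _ ≤ tailConst R * (D * L) / n := by
        gcongr
        exact le_tailConst_mul hR hD hL
    _ = _ := by ring

theorem exists_estimator (hR : 0 ≤ R) (hk : 1 ≤ k) (hn : 1 ≤ n) :
    ∃ sel : (Fin n → E) → AtomicMeasure (Fin k) E, Measurable[_, ⊤] sel ∧
      (∀ x, (sel x).IsMixing R) ∧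
      ∀ γ : AtomicMeasure (Fin k) E, γ.IsMixing R → ∀ δ : ℝ, 0 < δ → δ < 1 / 2 →
        Measure.pi (fun _ : Fin n => γ.law)
          {x | tailConst R * (effDim k (Module.finrank ℝ E) / n * Real.log (1 / δ))
            < sqHellinger (stdGaussian E) (sel x).density γ.density} ≤ ENNReal.ofReal δ := by
  have : (0 : ℝ) < n := by exact_mod_cast hn
  have card_eq : 2 * k = Fintype.card (Fin k ⊕ Fin k) := by simp [two_mul]
  have D_ge_one := one_le_effDim hk (Module.finrank ℝ E)
  set D := effDim k (Module.finrank ℝ E)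
  have tilt_pos := tiltConst_pos R (2 * k)
  have chi_pos : 0 < chiConst R (2 * k) := mul_pos (Real.exp_pos _) tilt_pos
  let ε := √(D / (n * chiConst R (2 * k)))
  have ε_pos : 0 < ε := by positivity
  have ε_sq : ε ^ 2 = D / (n * chiConst R (2 * k)) := Real.sq_sqrt (by positivity)
  have ε_eq : n * (chiConst R (2 * k) * ε ^ 2) = D := by
    rw [ε_sq]
    field_simp
  have : Nonempty (Fin k) := ⟨⟨0, hk⟩⟩
  obtain ⟨S, S_nonempty, hS, covering⟩ := exists_net (ι := Fin k) (E := E) hR ε_pos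
  obtain ⟨sel, sel_measurable, sel_mem, le_sel⟩ := exists_measurable_argmax S_nonempty
    (f := fun γ (x : Fin n → E) => ∏ i, γ.density (x i)) fun γ hγ => Finset.measurable_prod _
      fun i _ => (hS.isMixing γ hγ).isPosDensity.measurable.comp (measurable_pi_apply i)
  refine ⟨sel, sel_measurable, fun x => hS.isMixing _ (sel_mem x), fun γ h δ hδ hδ_half => ?_⟩
  obtain ⟨γ₀, h₀, hγ⟩ := covering γ h
  have concentration := hS.pi_sqHellinger_gt_le hR ε_pos sel_mem le_sel h h₀ hγ card_eq rfl
    (b := logRate R * (k : ℝ) ^ 2 + 3) (by have := logRate_pos hR; positivity)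
    ((packingDim_mul_exp_neg_le hR hk rfl).trans_eq (by rw [ε_sq]; field_simp; rfl))
    (8 / n * (D * (6 * logRate R + 14) + Real.log (1 / δ)))
  refine (measure_mono fun x hx => ?_).trans (concentration.trans (ENNReal.ofReal_le_ofReal ?_))
  · simp only [Set.mem_ofPred_eq] at hx ⊢
    contrapose! hx
    exact sqHellinger_le_of_net hR h (hS.isMixing _ h₀) (hS.isMixing _ (sel_mem x)) hγ hn
      D_ge_one (half_le_log_one_div hδ hδ_half) ε_eq hx
  · have exponent : n * (chiConst R (2 * k) * ε ^ 2
        - 8 / n * (D * (6 * logRate R + 14) + Real.log (1 / δ)) / 8) + D * (6 * logRate R + 13)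
        = Real.log δ := by
      rw [mul_sub, ε_eq, one_div, Real.log_inv]
      field_simp
      ring
    calc _ ≤ _ * _ := mul_le_mul_of_nonneg_left (packing_sum_le_exp hR hk rfl) (Real.exp_pos _).le
      _ = δ := by rw [← Real.exp_add, exponent, Real.exp_log hδ]

end Estimator

section ToMeasure

variable {ι E : Type*} [Fintype ι] [MeasurableSpace E]

/-- The measure `∑ i, wᵢ δ_{aᵢ}` with the weights and atoms of `γ`; negative weights count as
zero. -/
def toMeasure (γ : AtomicMeasure ι E) : Measure E :=
  ∑ i, ENNReal.ofReal (γ.weight i) • Measure.dirac (γ.atom i)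

variable [NormedAddCommGroup E] [InnerProductSpace ℝ E] [FiniteDimensional ℝ E] [BorelSpace E]
  {R : ℝ} {γ : AtomicMeasure ι E}

theorem IsMixing.conv_toMeasure (h : γ.IsMixing R) :
    Measure.conv γ.toMeasure (stdGaussian E) = γ.law := by
  ext s hs
  have shift (m : E) : ∫⁻ y, s.indicator 1 (m + y) ∂(stdGaussian E)
      = ∫⁻ y in s, ENNReal.ofReal (shiftDensity m y) ∂(stdGaussian E) := by
    rw [← lintegral_map (measurable_one.indicator hs) (measurable_const_add m),
      map_add_stdGaussian, lintegral_indicator_one hs, densityMeasure, withDensity_apply _ hs]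
  have measurable (i : ι) : Measurable fun y => ENNReal.ofReal (shiftDensity (γ.atom i) y) :=
    (isPosDensity_shiftDensity _).measurable.ennreal_ofReal
  have ofReal_density (y : E) : ENNReal.ofReal (γ.density y)
      = ∑ i, ENNReal.ofReal (γ.weight i) * ENNReal.ofReal (shiftDensity (γ.atom i) y) :=
    (ENNReal.ofReal_sum_of_nonneg fun i _ =>
      mul_nonneg (h.weight_nonneg i) (shiftDensity_pos _ _).le).trans
      (Finset.sum_congr rfl fun i _ => ENNReal.ofReal_mul (h.weight_nonneg i))
  rw [← lintegral_indicator_one hs, Measure.lintegral_conv (measurable_one.indicator hs),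
    toMeasure, lintegral_finsetSum_measure, law, densityMeasure, withDensity_apply _ hs]
  simp only [lintegral_smul_measure, lintegral_dirac, shift, smul_eq_mul, ofReal_density]
  rw [lintegral_finsetSum _ fun i _ => (measurable i).const_mul _]
  exact Finset.sum_congr rfl fun i _ => (lintegral_const_mul _ (measurable i)).symm

end ToMeasure

variable {R : ℝ} {d k : ℕ} {γ γ' : AtomicMeasure (Fin k) (EuclideanSpace ℝ (Fin d))}

theorem IsMixing.mixture_toMeasure (h : γ.IsMixing R) : mixture γ.toMeasure = γ.law :=
  h.conv_toMeasure

theorem IsMixing.sampleLaw_toMeasure (h : γ.IsMixing R) (n : ℕ) :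
    sampleLaw n γ.toMeasure = Measure.pi fun _ : Fin n => γ.law := by
  rw [sampleLaw, h.mixture_toMeasure]

theorem IsMixing.hellinger_mixture (h : γ.IsMixing R) (h' : γ'.IsMixing R) :
    hellinger (mixture γ.toMeasure) (mixture γ'.toMeasure)
      = √(sqHellinger (stdGaussian _) γ.density γ'.density) := by
  rw [h.mixture_toMeasure, h'.mixture_toMeasure]
  exact h.isPosDensity.hellinger_eq h'.isPosDensity

end AtomicMeasure

section Mixture

variable {R : ℝ} {k d n : ℕ} {Γ : Measure (EuclideanSpace ℝ (Fin d))}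

theorem mem_mixingClass_iff : Γ ∈ mixingClass R k d ↔
    ∃ γ : AtomicMeasure (Fin k) (EuclideanSpace ℝ (Fin d)), γ.IsMixing R ∧ Γ = γ.toMeasure := by
  constructor
  · rintro ⟨w, μ, norm_le, nonneg, sum_eq, rfl⟩
    exact ⟨⟨w, μ⟩, ⟨norm_le, nonneg, sum_eq⟩, rfl⟩
  · rintro ⟨γ, ⟨norm_le, nonneg, sum_eq⟩, rfl⟩
    exact ⟨γ.weight, γ.atom, norm_le, nonneg, sum_eq, rfl⟩

theorem measurable_mixture : Measurable (mixture (d := d)) := by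
  refine (Measure.measurable_map _ measurable_add).comp ?_
  simp only [Measure.prod]
  exact Measure.measurable_bind' Measurable.map_prodMk_left

theorem isProbabilityMeasure_mixture (hΓ : Γ ∈ mixingClass R k d) :
    IsProbabilityMeasure (mixture Γ) := by
  obtain ⟨γ, h, rfl⟩ := mem_mixingClass_iff.1 hΓ
  rw [h.mixture_toMeasure]
  exact h.isPosDensity.isProbabilityMeasure

theorem minimaxRisk_le_properMinimaxRisk (R : ℝ) (k d n : ℕ) :
    minimaxRisk R k d n ≤ properMinimaxRisk R k d n :=
  le_iInf₂ fun Γhat h => iInf₂_le (fun x => mixture (Γhat x))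
    ⟨measurable_mixture.comp h.1, fun x => isProbabilityMeasure_mixture (h.2 x)⟩

theorem isMixingEstimator_toMeasure
    {sel : (Fin n → EuclideanSpace ℝ (Fin d)) → AtomicMeasure (Fin k) (EuclideanSpace ℝ (Fin d))}
    (hsel : Measurable[_, ⊤] sel) (h : ∀ x, (sel x).IsMixing R) :
    IsMixingEstimator R k fun x => (sel x).toMeasure :=
  ⟨(measurable_from_top (f := AtomicMeasure.toMeasure)).comp hsel,
    fun x => mem_mixingClass_iff.2 ⟨sel x, h x, rfl⟩⟩

theorem exists_isMixingEstimator (hR : 0 ≤ R) (hk : 1 ≤ k) (hn : 1 ≤ n) :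
    ∃ Γhat : (Fin n → EuclideanSpace ℝ (Fin d)) → Measure (EuclideanSpace ℝ (Fin d)),
      IsMixingEstimator R k Γhat ∧ ∀ Γ ∈ mixingClass R k d, ∀ δ : ℝ, 0 < δ → δ < 1 / 2 →
        ENNReal.ofReal (1 - δ) ≤ sampleLaw n Γ {x | hellinger (mixture (Γhat x)) (mixture Γ)
          ≤ √(tailConst R) * √(effDim k d / n * Real.log (1 / δ))} := by
  obtain ⟨sel, sel_measurable, sel_mixing, tail⟩ :=
    AtomicMeasure.exists_estimator (E := EuclideanSpace ℝ (Fin d)) hR hk hn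
  refine ⟨_, isMixingEstimator_toMeasure sel_measurable sel_mixing, fun Γ hΓ δ hδ hδ_half => ?_⟩
  obtain ⟨γ, h, rfl⟩ := mem_mixingClass_iff.1 hΓ
  have : IsProbabilityMeasure γ.law := h.isPosDensity.isProbabilityMeasure
  have loss_measurable : Measurable fun x =>
      sqHellinger (stdGaussian _) (sel x).density γ.density :=
    (measurable_from_top (f := fun γ' : AtomicMeasure (Fin k) _ =>
      sqHellinger (stdGaussian _) γ'.density γ.density)).comp sel_measurable
  have exceptional_le := tail γ h δ hδ hδ_half
  rw [finrank_euclideanSpace_fin] at exceptional_le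
  rw [h.sampleLaw_toMeasure]
  calc ENNReal.ofReal (1 - δ) = 1 - ENNReal.ofReal δ := by
        rw [ENNReal.ofReal_sub _ hδ.le, ENNReal.ofReal_one]
    _ ≤ _ := tsub_le_tsub_left exceptional_le 1
    _ = _ := (prob_compl_eq_one_sub (measurableSet_lt measurable_const loss_measurable)).symm
    _ ≤ _ := measure_mono fun x hx => ?_
  simp only [Set.mem_compl_iff, Set.mem_ofPred_eq, not_lt] at hx ⊢
  rw [(sel_mixing x).hellinger_mixture h, ← Real.sqrt_mul (tailConst_pos hR).le]
  exact Real.sqrt_le_sqrt hx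

end Mixture

section ExponentialTail

variable {Ω : Type*} [MeasurableSpace Ω] {P : Measure Ω} [IsProbabilityMeasure P] {z : Ω → ℝ}

theorem lintegral_le_two_of_exp_tail (hz : Measurable z) (hz₀ : ∀ x, 0 ≤ z x)
    (tail : ∀ t : ℝ, 1 < t → P {x | t < z x} ≤ ENNReal.ofReal (Real.exp (-t))) :
    ∫⁻ x, ENNReal.ofReal (z x) ∂P ≤ 2 := by
  have small : ∫⁻ t in Set.Ioc (0 : ℝ) 1, P {x | t < z x} ≤ 1 :=
    calc _ ≤ ∫⁻ _ in Set.Ioc (0 : ℝ) 1, 1 := lintegral_mono fun _ => prob_le_one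
      _ = 1 := by simp
  have large : ∫⁻ t in Set.Ioi (1 : ℝ), P {x | t < z x} ≤ 1 :=
    calc _ ≤ ∫⁻ t in Set.Ioi (1 : ℝ), ENNReal.ofReal (Real.exp (-t)) :=
          setLIntegral_mono (by fun_prop) tail
      _ = ENNReal.ofReal (∫ t in Set.Ioi (1 : ℝ), Real.exp (-t)) :=
          (ofReal_integral_eq_lintegral_ofReal (integrableOn_exp_neg_Ioi 1)
            (ae_of_all _ fun _ => (Real.exp_pos _).le)).symm
      _ ≤ 1 := by
          rw [integral_exp_neg_Ioi]
          exact ENNReal.ofReal_le_one.2 (Real.exp_le_one_iff.2 (by norm_num))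
  rw [lintegral_eq_lintegral_meas_lt P (ae_of_all _ hz₀) hz.aemeasurable,
    ← Set.Ioc_union_Ioi_eq_Ioi zero_le_one]
  calc _ ≤ _ := lintegral_union_le _ _ _
    _ ≤ (1 : ℝ≥0∞) + 1 := add_le_add small large
    _ = 2 := one_add_one_eq_two

theorem lintegral_sqrt_le_of_exp_tail (hz : Measurable z) (hz₀ : ∀ x, 0 ≤ z x) {B : ℝ}
    (hB : 0 < B)
    (tail : ∀ t : ℝ, 1 < t → P {x | B * t < z x} ≤ ENNReal.ofReal (Real.exp (-t))) :
    ∫⁻ x, ENNReal.ofReal (√(z x)) ∂P ≤ ENNReal.ofReal (3 * √B) := by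
  have ratio_nonneg (x : Ω) : 0 ≤ z x / B := div_nonneg (hz₀ x) hB.le
  have ratio_le : ∫⁻ x, ENNReal.ofReal (z x / B) ∂P ≤ 2 :=
    lintegral_le_two_of_exp_tail (hz.div_const B) ratio_nonneg
      (by simpa only [lt_div_iff₀' hB] using tail)
  have sqrt_le (x : Ω) : √(z x) ≤ √B * (1 + z x / B) :=
    calc √(z x) = √B * √(z x / B) := by rw [← Real.sqrt_mul hB.le, mul_div_cancel₀ _ hB.ne']
      _ ≤ _ := by
          gcongr
          exact Real.sqrt_le_iff.2 ⟨by linarith [ratio_nonneg x], by nlinarith [ratio_nonneg x]⟩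
  calc _ ≤ ∫⁻ x, ENNReal.ofReal (√B) * (1 + ENNReal.ofReal (z x / B)) ∂P := by
        refine lintegral_mono fun x => (ENNReal.ofReal_le_ofReal (sqrt_le x)).trans_eq ?_
        rw [ENNReal.ofReal_mul (Real.sqrt_nonneg B), ENNReal.ofReal_add zero_le_one
          (ratio_nonneg x), ENNReal.ofReal_one]
    _ = ENNReal.ofReal (√B) * (1 + ∫⁻ x, ENNReal.ofReal (z x / B) ∂P) := by
        rw [lintegral_const_mul' _ _ ENNReal.ofReal_ne_top, lintegral_add_left measurable_const,
          lintegral_one, measure_univ]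
    _ ≤ ENNReal.ofReal (√B) * (1 + 2) := by gcongr
    _ = ENNReal.ofReal (3 * √B) := by
        rw [mul_comm 3 √B, ENNReal.ofReal_mul (Real.sqrt_nonneg B)]
        norm_num

end ExponentialTail

section UpperBound

variable {R : ℝ} {k d n : ℕ}

theorem properMinimaxRisk_le_min (hR : 0 ≤ R) (hk : 1 ≤ k) (hn : 1 ≤ n) :
    properMinimaxRisk R k d n
      ≤ ENNReal.ofReal (min (3 * √(tailConst R * (effDim k d / n))) 2) := by
  obtain ⟨sel, sel_measurable, sel_mixing, tail⟩ :=
    AtomicMeasure.exists_estimator (E := EuclideanSpace ℝ (Fin d)) hR hk hn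
  rw [finrank_euclideanSpace_fin] at tail
  refine iInf₂_le_of_le _ (isMixingEstimator_toMeasure sel_measurable sel_mixing)
    (iSup₂_le fun Γ hΓ => ?_)
  obtain ⟨γ, h, rfl⟩ := mem_mixingClass_iff.1 hΓ
  have : IsProbabilityMeasure γ.law := h.isPosDensity.isProbabilityMeasure
  simp only [risk, h.sampleLaw_toMeasure, fun x => (sel_mixing x).hellinger_mixture h,
    ENNReal.ofReal_min]
  refine le_min ?_ ?_
  · have := tailConst_pos hR
    have := one_le_effDim hk d
    refine lintegral_sqrt_le_of_exp_tail ((measurable_from_top (f := fun γ' :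
      AtomicMeasure (Fin k) _ => sqHellinger (stdGaussian _) γ'.density γ.density)).comp
      sel_measurable) (fun x => sqHellinger_nonneg _ _ _) (by positivity) fun t ht => ?_
    have exp_lt : Real.exp (-t) < 1 / 2 := by
      rw [Real.exp_neg, one_div]
      exact inv_strictAnti₀ two_pos (by linarith [Real.add_one_le_exp t])
    simpa [mul_assoc] using tail γ h (Real.exp (-t)) (Real.exp_pos _) exp_lt
  · calc _ ≤ ∫⁻ _, ENNReal.ofReal 2 ∂(Measure.pi fun _ : Fin n => γ.law) := by
          refine lintegral_mono fun x => ENNReal.ofReal_le_ofReal (Real.sqrt_le_iff.2 ⟨?_, ?_⟩)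
          · norm_num
          · linarith [(sel_mixing x).isPosDensity.sqHellinger_le_two h.isPosDensity]
      _ = ENNReal.ofReal 2 := by simp

/-- The constant of the upper bound on the minimax risk at fixed `R` and `k`. -/
def upperConst (R : ℝ) (k : ℕ) : ℝ := 3 * √(tailConst R * effDim k 1) + 2

theorem upperConst_pos (R : ℝ) (k : ℕ) : 0 < upperConst R k := by
  unfold upperConst
  positivity

theorem effDim_le_mul (k : ℕ) (hd : 1 ≤ d) : effDim k d ≤ effDim k 1 * d := by
  have : (1 : ℝ) ≤ d := by exact_mod_cast hd
  rw [effDim, effDim, Nat.cast_one, mul_one, add_mul]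
  gcongr
  exact le_mul_of_one_le_right (by positivity) this

theorem properMinimaxRisk_le (hR : 0 ≤ R) (hk : 1 ≤ k) (hd : 1 ≤ d) (hn : 1 ≤ n) :
    properMinimaxRisk R k d n ≤ ENNReal.ofReal (upperConst R k * min (√(d / n)) 1) := by
  refine (properMinimaxRisk_le_min hR hk hn).trans (ENNReal.ofReal_le_ofReal ?_)
  have tail_pos := tailConst_pos hR
  rw [mul_min_of_nonneg _ _ (upperConst_pos R k).le]
  refine min_le_min ?_ ?_
  · calc 3 * √(tailConst R * (effDim k d / n))
        ≤ 3 * √(tailConst R * (effDim k 1 * d / n)) := by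
          gcongr
          exact effDim_le_mul k hd
      _ = 3 * √(tailConst R * effDim k 1) * √(d / n) := by
          rw [mul_assoc 3, ← Real.sqrt_mul' _ (by positivity), mul_assoc, mul_div_assoc]
      _ ≤ upperConst R k * √(d / n) := by
          gcongr
          exact le_add_of_nonneg_right zero_le_two
  · unfold upperConst
    linarith [Real.sqrt_nonneg (tailConst R * effDim k 1)]

end UpperBound

section TestFunction

variable {Ω : Type*} [MeasurableSpace Ω]

theorem sq_integral_mul_le {ν : Measure Ω} {f g : Ω → ℝ} (hf : MemLp f 2 ν) (hg : MemLp g 2 ν) :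
    (∫ x, f x * g x ∂ν) ^ 2 ≤ (∫ x, f x ^ 2 ∂ν) * ∫ x, g x ^ 2 ∂ν := by
  have hfg : Integrable (fun x => f x * g x) ν := hf.integrable_mul hg
  have split (t : ℝ) : ∫ x, (t * t * f x ^ 2 + 2 * t * (f x * g x) + g x ^ 2) ∂ν
      = t * t * ∫ x, f x ^ 2 ∂ν + 2 * t * ∫ x, f x * g x ∂ν + ∫ x, g x ^ 2 ∂ν := by
    have hf₂ := hf.integrable_sq.const_mul (t * t)
    have hfg₂ := hfg.const_mul (2 * t)
    have sum_integrable : Integrable (fun x => t * t * f x ^ 2 + 2 * t * (f x * g x)) ν :=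
      hf₂.add hfg₂
    rw [integral_add sum_integrable hg.integrable_sq, integral_add hf₂ hfg₂, integral_const_mul,
      integral_const_mul]
  have quadratic_nonneg (t : ℝ) : 0 ≤ (∫ x, f x ^ 2 ∂ν) * (t * t) + 2 * (∫ x, f x * g x ∂ν) * t
      + ∫ x, g x ^ 2 ∂ν :=
    calc 0 ≤ ∫ x, (t * f x + g x) ^ 2 ∂ν := integral_nonneg fun _ => sq_nonneg _
      _ = ∫ x, (t * t * f x ^ 2 + 2 * t * (f x * g x) + g x ^ 2) ∂ν := by
          congr 1 with x
          ring
      _ = _ := by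
          rw [split]
          ring
  have := discrim_le_zero quadratic_nonneg
  rw [discrim] at this
  linarith

theorem memLp_two_sqrt {ν : Measure Ω} {p : Ω → ℝ} (hp : Integrable p ν) (hp₀ : ∀ x, 0 ≤ p x) :
    MemLp (fun x => √(p x)) 2 ν := by
  refine (memLp_two_iff_integrable_sq
    (Real.continuous_sqrt.comp_aestronglyMeasurable hp.aestronglyMeasurable)).2 ?_
  simpa only [Real.sq_sqrt (hp₀ _)] using hp

theorem sq_integral_sub_mul_le {ν : Measure Ω} {p q g : Ω → ℝ} (hp : Integrable p ν)
    (hp₀ : ∀ x, 0 ≤ p x) (hq : Integrable q ν) (hq₀ : ∀ x, 0 ≤ q x) (hg : Measurable g)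
    (hg₁ : ∀ x, |g x| ≤ 1) :
    (∫ x, (p x - q x) * g x ∂ν) ^ 2
      ≤ sqHellinger ν p q * (2 * (∫ x, p x ∂ν + ∫ x, q x ∂ν)) := by
  have sqrt_p := memLp_two_sqrt hp hp₀
  have sqrt_q := memLp_two_sqrt hq hq₀
  have weighted : MemLp (fun x => (√(p x) + √(q x)) * g x) 2 ν :=
    (sqrt_p.add sqrt_q).mono ((sqrt_p.add sqrt_q).1.mul hg.aestronglyMeasurable) <|
      ae_of_all _ fun x => by
        rw [norm_mul]
        exact mul_le_of_le_one_right (norm_nonneg _) (hg₁ x)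
  have sq_weighted_le (x : Ω) : ((√(p x) + √(q x)) * g x) ^ 2 ≤ 2 * (p x + q x) :=
    calc _ = (√(p x) + √(q x)) ^ 2 * |g x| ^ 2 := by rw [mul_pow, sq_abs]
      _ ≤ (√(p x) + √(q x)) ^ 2 * 1 := by
          gcongr
          exact pow_le_one₀ (abs_nonneg _) (hg₁ x)
      _ ≤ 2 * (√(p x) ^ 2 + √(q x) ^ 2) := by linarith [add_sq_le (a := √(p x)) (b := √(q x))]
      _ = _ := by rw [Real.sq_sqrt (hp₀ x), Real.sq_sqrt (hq₀ x)]
  calc _ = (∫ x, (√(p x) - √(q x)) * ((√(p x) + √(q x)) * g x) ∂ν) ^ 2 := by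
        congr 2 with x
        rw [← mul_assoc, mul_comm (√(p x) - _), ← sq_sub_sq, Real.sq_sqrt (hp₀ x),
          Real.sq_sqrt (hq₀ x)]
    _ ≤ sqHellinger ν p q * ∫ x, ((√(p x) + √(q x)) * g x) ^ 2 ∂ν :=
        sq_integral_mul_le (sqrt_p.sub sqrt_q) weighted
    _ ≤ _ := by
        gcongr
        · exact sqHellinger_nonneg _ _ _
        · rw [← integral_add hp hq, ← integral_const_mul]
          exact integral_mono weighted.integrable_sq ((hp.add hq).const_mul 2) sq_weighted_le

theorem abs_integral_sub_le_two_mul_hellinger {P Q : Measure Ω} [IsProbabilityMeasure P]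
    [IsProbabilityMeasure Q] {g : Ω → ℝ} (hg : Measurable g) (hg₁ : ∀ x, |g x| ≤ 1) :
    |∫ x, g x ∂P - ∫ x, g x ∂Q| ≤ 2 * hellinger P Q := by
  have ac_P : P ≪ P + Q := Measure.absolutelyContinuous_of_le (Measure.le_add_right le_rfl)
  have ac_Q : Q ≪ P + Q := Measure.absolutelyContinuous_of_le (Measure.le_add_left le_rfl)
  let p (x : Ω) : ℝ := (P.rnDeriv (P + Q) x).toReal
  let q (x : Ω) : ℝ := (Q.rnDeriv (P + Q) x).toReal
  have hp : Integrable p (P + Q) := Measure.integrable_toReal_rnDeriv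
  have hq : Integrable q (P + Q) := Measure.integrable_toReal_rnDeriv
  have difference : ∫ x, g x ∂P - ∫ x, g x ∂Q = ∫ x, (p x - q x) * g x ∂(P + Q) := by
    have bounded : ∀ᵐ x ∂(P + Q), ‖g x‖ ≤ 1 := ae_of_all _ hg₁
    rw [← integral_rnDeriv_smul ac_P, ← integral_rnDeriv_smul ac_Q]
    simp only [sub_mul]
    exact (integral_sub (hp.mul_bdd hg.aestronglyMeasurable bounded)
      (hq.mul_bdd hg.aestronglyMeasurable bounded)).symm
  have sq_le := sq_integral_sub_mul_le hp (fun _ => ENNReal.toReal_nonneg) hq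
    (fun _ => ENNReal.toReal_nonneg) hg hg₁
  rw [Measure.integral_toReal_rnDeriv ac_P, Measure.integral_toReal_rnDeriv ac_Q,
    probReal_univ, probReal_univ] at sq_le
  rw [difference]
  refine (Real.abs_le_sqrt sq_le).trans_eq ?_
  rw [hellinger, mul_comm, Real.sqrt_mul (by norm_num),
    show (2 * (1 + 1) : ℝ) = 2 ^ 2 by norm_num, Real.sqrt_sq zero_le_two]
  rfl

theorem measurable_hellinger {α : Type*} [MeasurableSpace α]
    [MeasurableSpace.CountableOrCountablyGenerated α Ω] {κ : α → Measure Ω} (hκ : Measurable κ)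
    (hprob : ∀ a, IsProbabilityMeasure (κ a)) (Q : Measure Ω) [IsFiniteMeasure Q] :
    Measurable fun a => hellinger (κ a) Q := by
  let κ₁ : Kernel α Ω := ⟨κ, hκ⟩
  let κ₂ : Kernel α Ω := Kernel.const α Q
  have : IsMarkovKernel κ₁ := ⟨hprob⟩
  have rnDeriv_eq (a : α) : hellinger (κ a) Q = √(∫ x, (√(κ₁.rnDeriv (κ₁ + κ₂) a x).toReal
      - √(κ₂.rnDeriv (κ₁ + κ₂) a x).toReal) ^ 2 ∂((κ₁ + κ₂) a)) := by
    refine congrArg _ (integral_congr_ae ?_)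
    filter_upwards [κ₁.rnDeriv_eq_rnDeriv_measure (η := κ₁ + κ₂) (a := a),
      κ₂.rnDeriv_eq_rnDeriv_measure (η := κ₁ + κ₂) (a := a)] with x h₁ h₂
    rw [h₁, h₂]
    rfl
  have measurable_integrand : Measurable fun z : α × Ω =>
      (√(κ₁.rnDeriv (κ₁ + κ₂) z.1 z.2).toReal - √(κ₂.rnDeriv (κ₁ + κ₂) z.1 z.2).toReal) ^ 2 :=
    ((κ₁.measurable_rnDeriv (κ₁ + κ₂)).ennreal_toReal.sqrt.sub
      (κ₂.measurable_rnDeriv (κ₁ + κ₂)).ennreal_toReal.sqrt).pow_const 2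
  simp only [rnDeriv_eq]
  exact measurable_integrand.stronglyMeasurable.integral_kernel_prod_right'.measurable.sqrt

end TestFunction

section Affinity

variable {Ω : Type*} [MeasurableSpace Ω] {ν : Measure Ω} {p q : Ω → ℝ}

/-- The Hellinger affinity `∫ √(p q) dν` of two densities with respect to `ν`. -/
def affinity (ν : Measure Ω) (p q : Ω → ℝ) : ℝ := ∫ x, √(p x * q x) ∂ν

theorem densityMeasure_apply (hp : IsPosDensity ν p) {A : Set Ω} (hA : MeasurableSet A) :
    densityMeasure ν p A = ENNReal.ofReal (∫ x in A, p x ∂ν) := by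
  rw [densityMeasure, withDensity_apply _ hA,
    ofReal_integral_eq_lintegral_ofReal hp.integrable.restrict (ae_of_all _ hp.nonneg)]

/- Cauchy–Schwarz for the two functions which exchange the roles of `√p` and `√q` outside `A`: their
product is `√(p q)` everywhere. -/
theorem sq_affinity_le (hp : IsPosDensity ν p) (hq : IsPosDensity ν q) {A : Set Ω}
    (hA : MeasurableSet A) :
    affinity ν p q ^ 2
      ≤ (∫ x in A, p x ∂ν + ∫ x in Aᶜ, q x ∂ν) * (∫ x in A, q x ∂ν + ∫ x in Aᶜ, p x ∂ν) := by
  classical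
  have memLp_sqrt {r : Ω → ℝ} (hr : IsPosDensity ν r) : MemLp (fun x => √(r x)) 2 ν :=
    memLp_two_sqrt hr.integrable hr.nonneg
  have memLp_exchange {r s : Ω → ℝ} (hr : IsPosDensity ν r) (hs : IsPosDensity ν s) :
      MemLp (A.piecewise (fun x => √(r x)) fun x => √(s x)) 2 ν :=
    MemLp.piecewise hA ((memLp_sqrt hr).restrict A) ((memLp_sqrt hs).restrict Aᶜ)
  have integral_sq {r s : Ω → ℝ} (hr : IsPosDensity ν r) (hs : IsPosDensity ν s) :
      ∫ x, A.piecewise (fun x => √(r x)) (fun x => √(s x)) x ^ 2 ∂ν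
        = ∫ x in A, r x ∂ν + ∫ x in Aᶜ, s x ∂ν := by
    rw [← integral_piecewise hA hr.integrable.integrableOn hs.integrable.integrableOn]
    congr 1 with x
    by_cases hx : x ∈ A
    · simp only [Set.piecewise_eq_of_mem _ _ _ hx, Real.sq_sqrt (hr.nonneg x)]
    · simp only [Set.piecewise_eq_of_notMem _ _ _ hx, Real.sq_sqrt (hs.nonneg x)]
  rw [← integral_sq hp hq, ← integral_sq hq hp]
  refine le_of_eq_of_le ?_ (sq_integral_mul_le (memLp_exchange hp hq) (memLp_exchange hq hp))
  rw [affinity]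
  congr 2 with x
  by_cases hx : x ∈ A
  · simp only [Set.piecewise_eq_of_mem _ _ _ hx, Real.sqrt_mul (hp.nonneg x)]
  · simp only [Set.piecewise_eq_of_notMem _ _ _ hx, Real.sqrt_mul (hp.nonneg x), mul_comm]

theorem sq_affinity_div_two_le_testing_error (hp : IsPosDensity ν p) (hq : IsPosDensity ν q)
    {A : Set Ω} (hA : MeasurableSet A) :
    ENNReal.ofReal (affinity ν p q ^ 2 / 2) ≤ densityMeasure ν p A + densityMeasure ν q Aᶜ := by
  have mass_p := integral_add_compl hA hp.integrable
  have mass_q := integral_add_compl hA hq.integrable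
  have p_nonneg (B : Set Ω) : 0 ≤ ∫ x in B, p x ∂ν := integral_nonneg hp.nonneg
  have q_nonneg (B : Set Ω) : 0 ≤ ∫ x in B, q x ∂ν := integral_nonneg hq.nonneg
  rw [hp.integral_eq_one] at mass_p
  rw [hq.integral_eq_one] at mass_q
  rw [densityMeasure_apply hp hA, densityMeasure_apply hq hA.compl,
    ← ENNReal.ofReal_add (p_nonneg A) (q_nonneg Aᶜ)]
  refine ENNReal.ofReal_le_ofReal ((div_le_iff₀ two_pos).2 ((sq_affinity_le hp hq hA).trans ?_))
  gcongr
  · exact add_nonneg (p_nonneg A) (q_nonneg Aᶜ)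
  · linarith [p_nonneg A, q_nonneg Aᶜ]

theorem pi_densityMeasure [SigmaFinite ν] (hp : IsPosDensity ν p) (ι : Type*) [Fintype ι] :
    (Measure.pi fun _ : ι => densityMeasure ν p)
      = densityMeasure (Measure.pi fun _ : ι => ν) fun x => ∏ i, p (x i) := by
  have := hp.isProbabilityMeasure
  refine Measure.pi_eq fun s hs => ?_
  rw [densityMeasure, withDensity_apply _ (.univ_pi hs), Measure.restrict_pi_pi,
    ← ofReal_integral_eq_lintegral_ofReal (.fintype_prod fun i => hp.integrable.restrict)
      (ae_of_all _ fun x => Finset.prod_nonneg fun i _ => hp.nonneg _),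
    integral_fintype_prod_eq_prod (f := fun _ => p),
    ENNReal.ofReal_prod_of_nonneg fun i _ => integral_nonneg hp.nonneg]
  exact Finset.prod_congr rfl fun i _ => (densityMeasure_apply hp (hs i)).symm

theorem IsPosDensity.pi [SigmaFinite ν] (hp : IsPosDensity ν p) (ι : Type*) [Fintype ι] :
    IsPosDensity (Measure.pi fun _ : ι => ν) fun x => ∏ i, p (x i) where
  measurable := Finset.measurable_fun_prod _ fun i _ => hp.measurable.comp (measurable_pi_apply i)
  pos x := Finset.prod_pos fun i _ => hp.pos (x i)
  integrable := .fintype_prod fun _ => hp.integrable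
  integral_eq_one := by rw [integral_fintype_prod_eq_pow, hp.integral_eq_one, one_pow]

theorem affinity_pi [SigmaFinite ν] (hp : ∀ x, 0 ≤ p x) (hq : ∀ x, 0 ≤ q x) (ι : Type*)
    [Fintype ι] :
    affinity (Measure.pi fun _ : ι => ν) (fun x => ∏ i, p (x i)) (fun x => ∏ i, q (x i))
      = affinity ν p q ^ Fintype.card ι := by
  simp only [affinity, ← Finset.prod_mul_distrib,
    Real.sqrt_prod _ fun _ _ => mul_nonneg (hp _) (hq _)]
  exact integral_fintype_prod_eq_pow fun y => √(p y * q y)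

theorem affinity_pow_div_two_le_testing_error [SigmaFinite ν] (hp : IsPosDensity ν p)
    (hq : IsPosDensity ν q) {n : ℕ} {A : Set (Fin n → Ω)} (hA : MeasurableSet A) :
    ENNReal.ofReal (affinity ν p q ^ (2 * n) / 2)
      ≤ Measure.pi (fun _ => densityMeasure ν p) A
        + Measure.pi (fun _ => densityMeasure ν q) Aᶜ := by
  rw [pi_densityMeasure hp, pi_densityMeasure hq, mul_comm 2 n, pow_mul]
  simpa only [affinity_pi hp.nonneg hq.nonneg, Fintype.card_fin] using
    sq_affinity_div_two_le_testing_error (hp.pi (Fin n)) (hq.pi (Fin n)) hA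

end Affinity

section GaussianLocation

variable {E : Type*} [NormedAddCommGroup E] [InnerProductSpace ℝ E] [FiniteDimensional ℝ E]
  [MeasurableSpace E] {m m' : E} [BorelSpace E]

/-- The Gaussian measure with mean `m` and identity covariance. -/
def gaussianLaw (m : E) : Measure E := densityMeasure (stdGaussian E) (shiftDensity m)

instance (m : E) : IsProbabilityMeasure (gaussianLaw m) :=
  (isPosDensity_shiftDensity m).isProbabilityMeasure

theorem affinity_shiftDensity (m m' : E) :
    affinity (stdGaussian E) (shiftDensity m) (shiftDensity m')
      = Real.exp (-(‖m - m'‖ ^ 2 / 8)) := by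
  have sqrt_eq (x : E) : √(shiftDensity m x * shiftDensity m' x)
      = Real.exp (-((‖m‖ ^ 2 + ‖m'‖ ^ 2) / 4)) * Real.exp ⟪(1 / 2 : ℝ) • (m + m'), x⟫ := by
    rw [shiftDensity, shiftDensity, ← Real.exp_add, ← Real.exp_half, ← Real.exp_add,
      real_inner_smul_left, inner_add_left]
    ring_nf
  simp only [affinity, sqrt_eq]
  rw [integral_const_mul, integral_exp_inner_stdGaussian, ← Real.exp_add, norm_smul, mul_pow,
    norm_add_sq_real, norm_sub_sq_real, Real.norm_eq_abs, sq_abs]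
  ring_nf

theorem gaussian_testing_error_ge {n : ℕ} (h : n * ‖m - m'‖ ^ 2 ≤ 4) {A : Set (Fin n → E)}
    (hA : MeasurableSet A) :
    ENNReal.ofReal (1 / 6)
      ≤ Measure.pi (fun _ => gaussianLaw m) A + Measure.pi (fun _ => gaussianLaw m') Aᶜ := by
  refine (ENNReal.ofReal_le_ofReal ?_).trans (affinity_pow_div_two_le_testing_error
    (isPosDensity_shiftDensity m) (isPosDensity_shiftDensity m') hA)
  have third_le_exp : 1 / 3 ≤ Real.exp (-1) := by
    rw [Real.exp_neg, one_div]
    exact inv_anti₀ (Real.exp_pos _) (by linarith [Real.exp_one_lt_d9])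
  have exp_le : Real.exp (-1)
      ≤ affinity (stdGaussian E) (shiftDensity m) (shiftDensity m') ^ (2 * n) := by
    rw [affinity_shiftDensity, ← Real.exp_nat_mul]
    push_cast
    exact Real.exp_le_exp.2 (by linarith)
  linarith

theorem integral_sin_gaussianLaw (m v c : E) :
    ∫ x, Real.sin ⟪x - c, v⟫ ∂(gaussianLaw m)
      = Real.exp (-(‖v‖ ^ 2 / 2)) * Real.sin ⟪m - c, v⟫ := by
  have integrable : Integrable (fun x : E => Complex.exp (⟪m - c, v⟫ * Complex.I)
      * Complex.exp (⟪x, (0 : E)⟫ + ⟪x, v⟫ * Complex.I)) (stdGaussian E) := by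
    refine Integrable.of_bound (C := 1) (by fun_prop) (ae_of_all _ fun x => ?_)
    rw [norm_mul, Complex.norm_exp_ofReal_mul_I, inner_zero_right, Complex.ofReal_zero, zero_add,
      Complex.norm_exp_ofReal_mul_I, one_mul]
  have sin_eq (x : E) : Real.sin ⟪m + x - c, v⟫ = RCLike.im (Complex.exp (⟪m - c, v⟫ * Complex.I)
      * Complex.exp (⟪x, (0 : E)⟫ + ⟪x, v⟫ * Complex.I)) := by
    rw [inner_zero_right, Complex.ofReal_zero, zero_add, ← Complex.exp_add, ← add_mul,
      ← Complex.ofReal_add, ← inner_add_left, RCLike.im_eq_complex_im, Complex.exp_ofReal_mul_I_im,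
      add_sub_right_comm]
  have char_fun : ∫ x : E, Complex.exp (⟪x, (0 : E)⟫ + ⟪x, v⟫ * Complex.I) ∂(stdGaussian E)
      = (Real.exp (-(‖v‖ ^ 2 / 2)) : ℝ) := by
    rw [integral_cexp_inner_stdGaussian]
    push_cast
    congr 1
    simp
    ring
  rw [gaussianLaw, ← map_add_stdGaussian, integral_map (by fun_prop) (by fun_prop)]
  simp_rw [sin_eq]
  rw [integral_im integrable, integral_const_mul, char_fun, mul_comm, RCLike.im_eq_complex_im,
    Complex.im_ofReal_mul, Complex.exp_ofReal_mul_I_im]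

/- A unit frequency in the direction of `m - m'`, with phase centred between the two means. -/
theorem exists_test_function (h : ‖m - m'‖ ≤ 2) :
    ∃ g : E → ℝ, Measurable g ∧ (∀ x, |g x| ≤ 1) ∧
      ‖m - m'‖ / 4 ≤ ∫ x, g x ∂(gaussianLaw m) - ∫ x, g x ∂(gaussianLaw m') := by
  set s := ‖m - m'‖ with hs
  have s_nonneg : 0 ≤ s := norm_nonneg _
  set c := (1 / 2 : ℝ) • (m + m') with hc
  set v := s⁻¹ • (m - m') with hv
  have norm_v : ‖v‖ ≤ 1 := by
    rw [hv, norm_smul, norm_inv, Real.norm_of_nonneg s_nonneg]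
    exact inv_mul_le_one
  have phase : ⟪m - c, v⟫ = s / 2 := by
    rw [show m - c = (1 / 2 : ℝ) • (m - m') by rw [hc]; module, hv, real_inner_smul_left,
      real_inner_smul_right, real_inner_self_eq_norm_sq, ← hs]
    rcases s_nonneg.eq_or_lt with h | h
    · simp [← h]
    · field_simp
  have phase' : ⟪m' - c, v⟫ = -(s / 2) := by
    rw [← phase, ← inner_neg_left, show m' - c = -(m - c) by rw [hc]; module]
  have half_le_exp : 1 / 2 ≤ Real.exp (-(‖v‖ ^ 2 / 2)) := by
    linarith [pow_le_one₀ (norm_nonneg v) norm_v (n := 2), Real.add_one_le_exp (-(‖v‖ ^ 2 / 2))]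
  have quarter_le_sin : s / 4 ≤ Real.sin (s / 2) :=
    calc s / 4 = 2 / 4 * (s / 2) := by ring
      _ ≤ 2 / Real.pi * (s / 2) := by
          gcongr
          exact Real.pi_le_four
      _ ≤ _ := Real.mul_le_sin (by linarith) (by linarith [Real.pi_gt_three])
  refine ⟨fun x => Real.sin ⟪x - c, v⟫, by fun_prop, fun x => Real.abs_sin_le_one _, ?_⟩
  rw [integral_sin_gaussianLaw, integral_sin_gaussianLaw, phase, phase', Real.sin_neg]
  nlinarith [mul_le_mul_of_nonneg_right half_le_exp (by linarith : 0 ≤ Real.sin (s / 2))]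

theorem norm_sub_le_hellinger_add_hellinger (h : ‖m - m'‖ ≤ 2) (P : Measure E)
    [IsProbabilityMeasure P] :
    ‖m - m'‖ ≤ 8 * (hellinger P (gaussianLaw m) + hellinger P (gaussianLaw m')) := by
  obtain ⟨g, measurable, bounded, separates⟩ := exists_test_function h
  have near := neg_le_of_abs_le <| abs_integral_sub_le_two_mul_hellinger (P := P)
    (Q := gaussianLaw m) measurable bounded
  have near' := le_of_abs_le <| abs_integral_sub_le_two_mul_hellinger (P := P)
    (Q := gaussianLaw m') measurable bounded
  linarith

end GaussianLocation

section Cube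

variable {ι : Type*}

/-- The vertices of the cube with side length `2 * a` around the origin. -/
def cubeVertex (a : ℝ) (τ : ι → Bool) : EuclideanSpace ℝ ι :=
  WithLp.toLp 2 fun i => if τ i then a else -a

/-- Change the `i`-th bit. -/
def flipAt [DecidableEq ι] (i : ι) (τ : ι → Bool) : ι → Bool := Function.update τ i (!τ i)

theorem flipAt_involutive [DecidableEq ι] (i : ι) : Function.Involutive (flipAt i) :=
  fun τ => by simp [flipAt]

variable [Fintype ι]

theorem hammingDist_flipAt [DecidableEq ι] (i : ι) (τ : ι → Bool) :
    hammingDist τ (flipAt i τ) = 1 := by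
  rw [hammingDist, Finset.card_eq_one]
  refine ⟨i, Finset.ext fun j => ?_⟩
  rw [Finset.mem_filter_univ, Finset.mem_singleton]
  by_cases h : j = i
  · subst h
    simp [flipAt]
  · simp [flipAt, h]

theorem sq_norm_cubeVertex (a : ℝ) (τ : ι → Bool) :
    ‖cubeVertex a τ‖ ^ 2 = Fintype.card ι * a ^ 2 := by
  have coord (i : ι) : cubeVertex a τ i ^ 2 = a ^ 2 := by
    simp only [cubeVertex]
    split_ifs
    · rfl
    · exact neg_sq a
  simp [EuclideanSpace.real_norm_sq_eq, coord]

theorem sq_norm_cubeVertex_sub (a : ℝ) (τ τ' : ι → Bool) :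
    ‖cubeVertex a τ - cubeVertex a τ'‖ ^ 2 = 4 * a ^ 2 * hammingDist τ τ' := by
  rw [EuclideanSpace.real_norm_sq_eq, hammingDist, Finset.card_filter, Nat.cast_sum,
    Finset.mul_sum]
  refine Finset.sum_congr rfl fun i _ => ?_
  simp only [cubeVertex, PiLp.sub_apply]
  cases τ i <;> cases τ' i <;> simp <;> ring

variable {Ω : Type*} [MeasurableSpace Ω]

theorem lintegral_hammingDist (P : Measure Ω) {sel : Ω → ι → Bool} (hsel : Measurable sel)
    (τ : ι → Bool) :
    ∫⁻ x, hammingDist (sel x) τ ∂P = ∑ i, P {x | sel x i ≠ τ i} := by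
  have event (i : ι) : MeasurableSet {x | sel x i ≠ τ i} :=
    (measurableSet_eq_fun ((measurable_pi_apply i).comp hsel) measurable_const).compl
  simp only [← lintegral_indicator_one (event _)]
  rw [← lintegral_finsetSum _ fun i _ => measurable_one.indicator (event i)]
  refine lintegral_congr fun x => ?_
  simp [hammingDist, Finset.card_filter, Set.indicator_apply]

/- Assouad's lemma: pair up the vertices along each direction of the cube. -/
theorem card_mul_le_two_mul_iSup_lintegral_hammingDist [DecidableEq ι]
    {P : (ι → Bool) → Measure Ω} {β : ℝ≥0∞}
    (h : ∀ i τ A, MeasurableSet A → β ≤ P τ A + P (flipAt i τ) Aᶜ) {sel : Ω → ι → Bool}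
    (hsel : Measurable sel) :
    Fintype.card ι * β ≤ 2 * ⨆ τ, ∫⁻ x, hammingDist (sel x) τ ∂(P τ) := by
  let mistake (i : ι) (τ : ι → Bool) : ℝ≥0∞ := P τ {x | sel x i ≠ τ i}
  let K : ℝ≥0∞ := Fintype.card (ι → Bool)
  have pair (i : ι) (τ : ι → Bool) : β ≤ mistake i τ + mistake i (flipAt i τ) := by
    have compl : {x | sel x i ≠ flipAt i τ i} = {x | sel x i ≠ τ i}ᶜ := by
      ext x
      simp only [flipAt, Function.update_self, Set.mem_ofPred_eq, Set.mem_compl_iff, not_not]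
      cases sel x i <;> cases τ i <;> simp
    simp only [mistake, compl]
    exact h i τ _
      (measurableSet_eq_fun ((measurable_pi_apply i).comp hsel) measurable_const).compl
  have direction (i : ι) : K * β ≤ 2 * ∑ τ, mistake i τ :=
    calc K * β = ∑ _τ : ι → Bool, β := by simp [K]
      _ ≤ ∑ τ, (mistake i τ + mistake i (flipAt i τ)) := Finset.sum_le_sum fun τ _ => pair i τ
      _ = 2 * ∑ τ, mistake i τ := by
          rw [Finset.sum_add_distrib, (flipAt_involutive i).bijective.sum_comp (mistake i), two_mul]
  refine (ENNReal.mul_le_mul_iff_right (a := K) (by simp [K]) (by simp [K])).1 ?_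
  calc K * (Fintype.card ι * β) = ∑ _i : ι, K * β := by
        rw [Finset.sum_const, Finset.card_univ, nsmul_eq_mul, mul_left_comm]
    _ ≤ ∑ i, 2 * ∑ τ, mistake i τ := Finset.sum_le_sum fun i _ => direction i
    _ = 2 * ∑ τ, ∫⁻ x, hammingDist (sel x) τ ∂(P τ) := by
        rw [← Finset.mul_sum, Finset.sum_comm]
        simp only [lintegral_hammingDist _ hsel, mistake]
    _ ≤ 2 * ∑ _τ : ι → Bool, ⨆ τ, ∫⁻ x, hammingDist (sel x) τ ∂(P τ) := by
        gcongr with τ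
        exact le_iSup (fun τ => ∫⁻ x, hammingDist (sel x) τ ∂(P τ)) τ
    _ = _ := by
        rw [Finset.sum_const, Finset.card_univ, nsmul_eq_mul, mul_left_comm]

end Cube

section VertexEstimator

variable {ι : Type*} [Fintype ι] {a : ℝ}

theorem norm_cubeVertex (ha : 0 ≤ a) (τ : ι → Bool) :
    ‖cubeVertex a τ‖ = √(Fintype.card ι) * a := by
  rw [← Real.sqrt_sq (norm_nonneg _), sq_norm_cubeVertex, Real.sqrt_mul (Nat.cast_nonneg _),
    Real.sqrt_sq ha]

theorem two_mul_mul_hammingDist_le (a : ℝ) (τ τ' : ι → Bool) :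
    2 * a * hammingDist τ τ' ≤ √(Fintype.card ι) * ‖cubeVertex a τ - cubeVertex a τ'‖ := by
  refine le_of_sq_le_sq ?_ (by positivity)
  rw [mul_pow (√_), Real.sq_sqrt (Nat.cast_nonneg _), sq_norm_cubeVertex_sub]
  calc (2 * a * hammingDist τ τ') ^ 2
      = hammingDist τ τ' * (4 * a ^ 2 * hammingDist τ τ') := by ring
    _ ≤ Fintype.card ι * (4 * a ^ 2 * hammingDist τ τ') := by
        gcongr
        exact hammingDist_le_card_fintype

/- Round the estimate to the vertex whose Gaussian law is closest to it. -/
theorem exists_vertex_estimator (ha : 0 ≤ a) (h : √(Fintype.card ι) * a ≤ 1) {Ω : Type*}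
    [MeasurableSpace Ω] {Phat : Ω → Measure (EuclideanSpace ℝ ι)} (hPhat : Measurable Phat)
    (hprob : ∀ x, IsProbabilityMeasure (Phat x)) :
    ∃ sel : Ω → ι → Bool, Measurable sel ∧ ∀ x τ,
      a * hammingDist (sel x) τ
        ≤ 8 * √(Fintype.card ι) * hellinger (Phat x) (gaussianLaw (cubeVertex a τ)) := by
  classical
  obtain ⟨sel, measurable_sel, -, nearest⟩ := exists_measurable_argmax (S := Finset.univ)
    Finset.univ_nonempty (f := fun τ x => -hellinger (Phat x) (gaussianLaw (cubeVertex a τ)))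
    fun τ _ => (measurable_hellinger hPhat hprob _).neg
  refine ⟨sel, (measurable_from_top (f := id)).comp measurable_sel, fun x τ => ?_⟩
  have := hprob x
  have close : ‖cubeVertex a (sel x) - cubeVertex a τ‖ ≤ 2 := by
    refine (norm_sub_le _ _).trans ?_
    rw [norm_cubeVertex ha, norm_cubeVertex ha]
    linarith
  have separated := norm_sub_le_hellinger_add_hellinger close (Phat x)
  have nearer := nearest x τ (Finset.mem_univ τ)
  have : 2 * a * hammingDist (sel x) τ
      ≤ √(Fintype.card ι) * (16 * hellinger (Phat x) (gaussianLaw (cubeVertex a τ))) :=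
    (two_mul_mul_hammingDist_le a _ _).trans (by gcongr; linarith)
  linarith

end VertexEstimator

section LowerBound

variable {R a : ℝ} {k d n : ℕ}

theorem dirac_mem_mixingClass (hk : 1 ≤ k) {m : EuclideanSpace ℝ (Fin d)} (hm : ‖m‖ ≤ R) :
    Measure.dirac m ∈ mixingClass R k d := by
  have weight_nonneg : 0 ≤ (Pi.single ⟨0, hk⟩ 1 : Fin k → ℝ) := Pi.single_nonneg.2 zero_le_one
  refine ⟨Pi.single ⟨0, hk⟩ 1, fun _ => m, fun _ => hm, weight_nonneg, by simp, ?_⟩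
  rw [← Finset.sum_smul, ← ENNReal.ofReal_sum_of_nonneg fun j _ => weight_nonneg j]
  simp

theorem mixture_dirac (m : EuclideanSpace ℝ (Fin d)) :
    mixture (Measure.dirac m) = gaussianLaw m := by
  rw [mixture, Measure.dirac_conv, map_add_stdGaussian, gaussianLaw]

theorem card_mul_le_iSup_lintegral_hammingDist (h : √n * a ≤ 1) (ha : 0 ≤ a)
    {sel : (Fin n → EuclideanSpace ℝ (Fin d)) → Fin d → Bool} (hsel : Measurable sel) :
    d * ENNReal.ofReal (1 / 6) ≤ 2 * ⨆ τ : Fin d → Bool,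
      ∫⁻ x, hammingDist (sel x) τ ∂(Measure.pi fun _ => gaussianLaw (cubeVertex a τ)) := by
  have testing (i : Fin d) (τ : Fin d → Bool) (A : Set (Fin n → EuclideanSpace ℝ (Fin d)))
      (hA : MeasurableSet A) : ENNReal.ofReal (1 / 6)
        ≤ Measure.pi (fun _ => gaussianLaw (cubeVertex a τ)) A
          + Measure.pi (fun _ => gaussianLaw (cubeVertex a (flipAt i τ))) Aᶜ := by
    refine gaussian_testing_error_ge ?_ hA
    rw [sq_norm_cubeVertex_sub, hammingDist_flipAt]
    have := pow_le_one₀ (by positivity) h (n := 2)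
    rw [mul_pow, Real.sq_sqrt (Nat.cast_nonneg n)] at this
    push_cast
    linarith
  simpa using card_mul_le_two_mul_iSup_lintegral_hammingDist testing hsel

theorem mul_lintegral_hammingDist_le_iSup_risk (hk : 1 ≤ k) (ha : 0 ≤ a) (haR : √d * a ≤ R)
    {b : ℝ} (hb : 0 ≤ b)
    {Phat : (Fin n → EuclideanSpace ℝ (Fin d)) → Measure (EuclideanSpace ℝ (Fin d))}
    {sel : (Fin n → EuclideanSpace ℝ (Fin d)) → Fin d → Bool}
    (hsel : ∀ x τ, a * hammingDist (sel x) τ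
      ≤ b * hellinger (Phat x) (gaussianLaw (cubeVertex a τ))) (τ : Fin d → Bool) :
    ENNReal.ofReal a * ∫⁻ x, hammingDist (sel x) τ
        ∂(Measure.pi fun _ => gaussianLaw (cubeVertex a τ))
      ≤ ENNReal.ofReal b * ⨆ Γ ∈ mixingClass R k d, risk Phat Γ := by
  have mem : Measure.dirac (cubeVertex a τ) ∈ mixingClass R k d :=
    dirac_mem_mixingClass hk (by rwa [norm_cubeVertex ha, Fintype.card_fin])
  refine le_trans ?_ (mul_le_mul_right
    (le_iSup₂ (f := fun Γ (_ : Γ ∈ mixingClass R k d) => risk Phat Γ) _ mem) _)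
  rw [risk, sampleLaw, mixture_dirac, ← lintegral_const_mul' _ _ ENNReal.ofReal_ne_top,
    ← lintegral_const_mul' _ _ ENNReal.ofReal_ne_top]
  refine lintegral_mono fun x => ?_
  rw [← ENNReal.ofReal_natCast, ← ENNReal.ofReal_mul ha, ← ENNReal.ofReal_mul hb]
  exact ENNReal.ofReal_le_ofReal (hsel x τ)

theorem ofReal_le_iSup_risk (hk : 1 ≤ k) (hd : 1 ≤ d) (ha : 0 ≤ a) (haR : √d * a ≤ R)
    (had : √d * a ≤ 1) (han : √n * a ≤ 1)
    {Phat : (Fin n → EuclideanSpace ℝ (Fin d)) → Measure (EuclideanSpace ℝ (Fin d))}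
    (hPhat : IsEstimator Phat) :
    ENNReal.ofReal (√d * a / 96) ≤ ⨆ Γ ∈ mixingClass R k d, risk Phat Γ := by
  set M := ⨆ Γ ∈ mixingClass R k d, risk Phat Γ
  obtain ⟨sel, measurable_sel, sel_le⟩ := exists_vertex_estimator (ι := Fin d) ha
    (by rwa [Fintype.card_fin]) hPhat.1 hPhat.2
  rw [Fintype.card_fin] at sel_le
  have key : ENNReal.ofReal (16 * √d) * ENNReal.ofReal (√d * a / 96)
      ≤ ENNReal.ofReal (16 * √d) * M :=
    calc ENNReal.ofReal (16 * √d) * ENNReal.ofReal (√d * a / 96)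
        = ENNReal.ofReal a * (d * ENNReal.ofReal (1 / 6)) := by
          rw [← ENNReal.ofReal_natCast, ← ENNReal.ofReal_mul (by positivity),
            ← ENNReal.ofReal_mul (by positivity), ← ENNReal.ofReal_mul ha]
          congr 1
          linear_combination a / 6 * Real.mul_self_sqrt (Nat.cast_nonneg (α := ℝ) d)
      _ ≤ ENNReal.ofReal a * (2 * ⨆ τ : Fin d → Bool, ∫⁻ x, hammingDist (sel x) τ
            ∂(Measure.pi fun _ => gaussianLaw (cubeVertex a τ))) :=
          mul_le_mul_right (card_mul_le_iSup_lintegral_hammingDist han ha measurable_sel) _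
      _ ≤ 2 * (ENNReal.ofReal (8 * √d) * M) := by
          rw [mul_left_comm, ENNReal.mul_iSup]
          gcongr
          exact iSup_le fun τ =>
            mul_lintegral_hammingDist_le_iSup_risk hk ha haR (by positivity) sel_le τ
      _ = ENNReal.ofReal (16 * √d) * M := by
          rw [← mul_assoc, ← ENNReal.ofReal_ofNat 2, ← ENNReal.ofReal_mul zero_le_two]
          ring_nf
  have : 0 < √(d : ℝ) := Real.sqrt_pos.2 (by exact_mod_cast hd)
  exact (ENNReal.mul_le_mul_iff_right (by simpa) ENNReal.ofReal_ne_top).1 key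

theorem le_minimaxRisk (hR : 0 ≤ R) (hk : 1 ≤ k) (hd : 1 ≤ d) (hn : 1 ≤ n) :
    ENNReal.ofReal (min R 1 / 96 * min (√((d : ℝ) / (n : ℝ))) 1) ≤ minimaxRisk R k d n := by
  refine le_iInf₂ fun Phat hPhat => ?_
  have sqrt_n_pos : 0 < √(n : ℝ) := Real.sqrt_pos.2 (by exact_mod_cast hn)
  have sqrt_d_pos : 0 < √(d : ℝ) := Real.sqrt_pos.2 (by exact_mod_cast hd)
  set r := min R 1
  set q := min (√((d : ℝ) / (n : ℝ))) 1
  have r_nonneg : 0 ≤ r := le_min hR zero_le_one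
  have : 0 ≤ q := le_min (Real.sqrt_nonneg _) zero_le_one
  have scale : √d * (r * q / √d) = r * q := mul_div_cancel₀ _ sqrt_d_pos.ne'
  have r_mul_q_le : r * q ≤ r := mul_le_of_le_one_right r_nonneg (min_le_right _ _)
  have sqrt_n_mul_q_le : √n * q ≤ √d := by
    rw [← le_div_iff₀' sqrt_n_pos, ← Real.sqrt_div (Nat.cast_nonneg d)]
    exact min_le_left _ _
  have sqrt_n_mul_le : √n * (r * q / √d) ≤ 1 := by
    rw [← mul_div_assoc, div_le_one sqrt_d_pos, mul_left_comm]
    exact (mul_le_of_le_one_left (by positivity) (min_le_right _ _)).trans sqrt_n_mul_q_le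
  have := ofReal_le_iSup_risk (k := k) (R := R) (n := n) hk hd (by positivity)
    (scale.trans_le (r_mul_q_le.trans (min_le_left _ _)))
    (scale.trans_le (r_mul_q_le.trans (min_le_right _ _))) sqrt_n_mul_le hPhat
  rwa [scale, mul_div_right_comm] at this

end LowerBound

end GaussianMixture

end

theorem theorem2 (R : ℝ) (hR : 0 < R) :
    -- the minimax rate, over all estimators and over proper estimators
    (∀ k : ℕ, 1 ≤ k → ∃ c C : ℝ, 0 < c ∧ 0 < C ∧ ∀ d n : ℕ, 1 ≤ d → 1 ≤ n →
      (ENNReal.ofReal (c * min (√((d : ℝ) / (n : ℝ))) 1)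
          ≤ GaussianMixture.minimaxRisk R k d n ∧
        GaussianMixture.minimaxRisk R k d n
          ≤ ENNReal.ofReal (C * min (√((d : ℝ) / (n : ℝ))) 1)) ∧
      (ENNReal.ofReal (c * min (√((d : ℝ) / (n : ℝ))) 1)
          ≤ GaussianMixture.properMinimaxRisk R k d n ∧
        GaussianMixture.properMinimaxRisk R k d n
          ≤ ENNReal.ofReal (C * min (√((d : ℝ) / (n : ℝ))) 1))) ∧
    -- a proper estimator with a high-probability guarantee at all confidence levels
    (∃ C : ℝ, 0 < C ∧ ∀ k d n : ℕ, 1 ≤ k → 1 ≤ d → 1 ≤ n →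
      ∃ Γhat : (Fin n → EuclideanSpace ℝ (Fin d)) → Measure (EuclideanSpace ℝ (Fin d)),
        GaussianMixture.IsMixingEstimator R k Γhat ∧
        ∀ Γ ∈ GaussianMixture.mixingClass R k d, ∀ δ : ℝ, 0 < δ → δ < 1 / 2 →
          ENNReal.ofReal (1 - δ) ≤ GaussianMixture.sampleLaw n Γ
            {x | GaussianMixture.hellinger (GaussianMixture.mixture (Γhat x))
                  (GaussianMixture.mixture Γ)
                ≤ C * √((((k : ℝ) ^ 4 * (d : ℝ) + (2 * (k : ℝ)) ^ (2 * k + 2)) / (n : ℝ))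
                    * Real.log (1 / δ))}) := by
  refine ⟨fun k hk => ⟨min R 1 / 96, GaussianMixture.upperConst R k,
    div_pos (lt_min hR one_pos) (by norm_num), GaussianMixture.upperConst_pos R k,
    fun d n hd hn => ?_⟩, √(GaussianMixture.tailConst R),
    Real.sqrt_pos.2 (GaussianMixture.tailConst_pos hR.le),
    fun k d n hk _ hn => GaussianMixture.exists_isMixingEstimator hR.le hk hn⟩
  have lower := GaussianMixture.le_minimaxRisk hR.le hk hd hn
  have le_proper := GaussianMixture.minimaxRisk_le_properMinimaxRisk R k d n
  have upper := GaussianMixture.properMinimaxRisk_le hR.le hk hd hn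
  exact ⟨⟨lower, le_proper.trans upper⟩, lower.trans le_proper, upper⟩
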